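/- **Well-scaled continuous-space limit of the space-time Mittag-Leffler process.** Let $\alpha,\beta\in(0,1]$, $\lambda_0,\xi>0$. For $\lambda>0$ the state probabilities $p_n(t)$ ($n\in\mathbb N_0$, $t\ge 0$) of the space-time Mittag-Leffler process are the solution of the Cauchy problem $$\frac{d^\beta}{dt^\beta}p_n(t)=-\xi(\lambda+1)\sum_{k=0}^n p_k(t)\,g_{n-k},\qquad p_n(0)=\delta_{n,0},\qquad \sum_{j\ge 0} g_j u^j=\frac{(1-u)^\alpha}{\lambda+(1-u)^\alpha},$$ with the Caputo derivative of order $\beta$ ($p_n$ continuous on $[0,\infty)$, $C^1$ on $(0,\infty)$, with $p_n'$ integrable near $0$). Let $\mathcal E^{(m)}_\alpha(\lambda,n)$ ($m,n\in\mathbb N_0$) be the coefficients in $\sum_n \mathcal E^{(m)}_\alpha(\lambda,n)u^n=[1+\lambda(1-u)^{-\alpha}]^{-m}$. Let $E^{\gamma}_{a,b}(z)=\sum_{s\ge0}\frac{(\gamma)_s}{s!}\frac{z^s}{\Gamma(as+b)}$ be the Prabhakar function, $\Theta$ the Heaviside function with $\Theta(0)=1$, $D_x$ the distributional derivative on $\mathbb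 R$, and define the distribution $$e^m_{\alpha,0}(-\lambda_0,x)=\delta(x)+\kappa_m(x),\qquad \kappa_m(x)=\Theta(x)\sum_{s\ge1}\frac{(m)_s(-\lambda_0)^s x^{\alpha s-1}}{s!\,\Gamma(\alpha s)} .$$ A sequence $(q_n)_{n\ge 0}$ on the lattice $h\mathbb N_0$ is identified with the function $x\mapsto \frac1h q_{\lfloor x/h\rfloor}$ on $[0,\infty)$, zero on $(-\infty,0)$ (value $\frac1h q_{x/h}$ at $x\in h\mathbb N_0$). "Limit in the sense of distributions" means convergence against every $\varphi\in C_c^\infty(\mathbb R)$. (a) For every $m\in\mathbb N_0$, as $h\to0^+$, $\frac1h\mathcal E^{(m)}_\alpha(\lambda_0h^\alpha,\lfloor x/h\rfloor)\to e^m_{\alpha,0}(-\lambda_0,x)$ in the sense of distributions, and $\frac1h\mathcal E^{(m)}_\alpha(\lambda_0h^\alpha,\lfloor x/h\rfloor)\to \kappa_m(x)$ for each $x>0$. Moreover $e^m_{\alpha,0}(-\lambda_0,x)=D_x[\Theta(x)E^m_{\alpha,1}(-\lambda_0x^\alpha)]$, and it is the Prabhakar kernel: for $s\in\mathbb C$ with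 $\Re s>0$, $(\Re s)^\alpha>\lambda_0$, the Laplace integral of $\kappa_m$ converges absolutely and $1+\int_0^\infty e^{-sx}\kappa_m(x)\,dx=(1+\lambda_0s^{-\alpha})^{-m}$. (b) For $h>0$ let $p^{(h)}_n(t)$ be the state probabilities with $\lambda=\lambda_0h^\alpha$. For every $t\ge0$ the limit of $\frac1hp^{(h)}_{\lfloor x/h\rfloor}(t)$ as $h\to0^+$ exists in the sense of distributions, and this state density $\mathcal P(x,t)$ satisfies $$\mathcal P(x,t)=\sum_{m=0}^\infty\frac{(-\xi t^\beta)^m}{\Gamma(\beta m+1)}\,e^m_{\alpha,0}(-\lambda_0,x)=D_x\Big[\Theta(x)\sum_{m=0}^\infty\frac{(-\xi t^\beta)^m}{\Gamma(\beta m+1)}E^m_{\alpha,1}(-\lambda_0x^\alpha)\Big],$$ where the first series converges in the sense of distributions and the second at every $x\ge0$. For each $x>0$ also $\frac1hp^{(h)}_{\lfloor x/h\rfloor}(t)\to\sum_{m}\frac{(-\xi t^\beta)^m}{\Gamma(\beta m+1)}\kappa_m(x)$, a convergent series. -/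

import Mathlib

open MeasureTheory Filter Topology TopologicalSpace Set
open scoped Distributions LineDeriv

noncomputable section

namespace SpaceTimeML

/-- The Prabhakar function `E^γ_{a,b}(z) = ∑ₛ (γ)ₛ / s! * z ^ s / Γ(a s + b)`. -/
def prabhakar (a b γ z : ℝ) : ℝ :=
  ∑' s : ℕ, (ascPochhammer ℝ s).eval γ / (s.factorial : ℝ) * (z ^ s / Real.Gamma (a * s + b))

/-- The `n`-th coefficient of the power series (generating function) of `f` at `0`. -/
def gfCoeff (f : ℝ → ℝ) (n : ℕ) : ℝ := iteratedDeriv n f 0 / (n.factorial : ℝ)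

/-- Generating function `g(1 - u) = (1 - u) ^ α / (lam + (1 - u) ^ α)` of the Mittag-Leffler
Laplacian matrix. -/
def gML (α lam u : ℝ) : ℝ := (1 - u) ^ α / (lam + (1 - u) ^ α)

/-- The discrete coefficients `𝓔_α^(m)(lam, n)`, with generating function
`∑ₙ 𝓔_α^(m)(lam, n) u ^ n = (1 + lam (1 - u) ^ (-α)) ^ (-m)`. -/
def discretePrabhakar (α : ℝ) (m : ℕ) (lam : ℝ) (n : ℕ) : ℝ :=
  gfCoeff (fun u => ((1 + lam * (1 - u) ^ (-α)) ^ m)⁻¹) n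

/-- The Caputo derivative of order `β ∈ (0, 1]` at `t > 0`. -/
def caputoDeriv (β : ℝ) (f : ℝ → ℝ) (t : ℝ) : ℝ :=
  if β = 1 then deriv f t
  else (Real.Gamma (1 - β))⁻¹ * ∫ τ in (0 : ℝ)..t, (t - τ) ^ (-β) * deriv f τ

/-- `p n t`, `n ∈ ℕ`, `t ≥ 0`, are the state probabilities of the space-time Mittag-Leffler process
with parameters `α, β, lam, ξ`: they solve the Cauchy problem
`d^β/dt^β p_n(t) = - ξ (lam + 1) ∑_{k ≤ n} p_k(t) g_{n-k}`, `p_n(0) = δ_{n,0}`, where `g_j` are the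
entries of the Laplacian matrix `L^α / (lam + L^α)`. The first three fields fix the usual class of
solutions in which the Caputo derivative is defined. -/
structure IsStateProb (α β lam ξ : ℝ) (p : ℕ → ℝ → ℝ) : Prop where
  continuousOn : ∀ n, ContinuousOn (p n) (Ici 0)
  contDiffOn : ∀ n, ContDiffOn ℝ 1 (p n) (Ioi 0)
  integrable_deriv : ∀ n, ∀ T : ℝ, IntegrableOn (deriv (p n)) (Ioc 0 T)
  init : ∀ n, p n 0 = if n = 0 then 1 else 0
  evol : ∀ n, ∀ t : ℝ, 0 < t →
    caputoDeriv β (p n) t =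
      -ξ * (lam + 1) * ∑ k ∈ Finset.range (n + 1), p k t * gfCoeff (gML α lam) (n - k)

/-- The regular distribution on `ℝ` given by a locally integrable function. -/
def regularDist (f : ℝ → ℝ) : 𝓓'((⊤ : Opens ℝ), ℝ) :=
  ContinuousLinearMap.toUniformConvergenceCLM _ _ _
    (TestFunction.integralAgainstBilinCLM (ContinuousLinearMap.mul ℝ ℝ) volume f)

/-- The density `x ↦ q_{⌊x / h⌋} / h` on `[0, ∞)` (and zero on `(-∞, 0)`) of a sequence `q` placed
on the lattice `h ℕ`, that is `∑ₙ q_n δ_h(x - h n)` with `δ_h = h⁻¹` on `[0, h)` and `0` elsewhere.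
For `x = h n` its value is `q_n / h`. -/
def latticeDensity (h : ℝ) (q : ℕ → ℝ) (x : ℝ) : ℝ :=
  if 0 ≤ x then (1 / h) * q ⌊x / h⌋₊ else 0

/-- The regular part `∑_{s ≥ 1} (γ)ₛ ζ ^ s x ^ (α s - 1) / (s! Γ(α s))`, `x > 0`, of the Prabhakar
kernel `e^γ_{α,0}(ζ, x)`. -/
def prabhakarDensity (α γ ζ x : ℝ) : ℝ :=
  if 0 < x then
    ∑' s : ℕ, (ascPochhammer ℝ (s + 1)).eval γ / ((s + 1).factorial : ℝ) *
      (ζ ^ (s + 1) * x ^ (α * ((s : ℝ) + 1) - 1) / Real.Gamma (α * ((s : ℝ) + 1)))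
  else 0

/-- The Prabhakar kernel `e^γ_{α,0}(ζ, ·)` as a distribution:
`δ(x) + ∑_{s ≥ 1} (γ)ₛ ζ ^ s x ^ (α s - 1) / (s! Γ(α s))`. -/
def prabhakarKernel (α γ ζ : ℝ) : 𝓓'((⊤ : Opens ℝ), ℝ) :=
  Distribution.delta 0 + regularDist (prabhakarDensity α γ ζ)

/-- The Heaviside function, with `Θ(0) = 1`. -/
def heaviside (x : ℝ) : ℝ := if 0 ≤ x then 1 else 0

/-- The coefficient `(-ξ t ^ β) ^ m / Γ(β m + 1)`. -/
def mlCoeff (β ξ t : ℝ) (m : ℕ) : ℝ := (-ξ * t ^ β) ^ m / Real.Gamma (β * m + 1)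

end SpaceTimeML

end

/-!
The binomial series expands a generating function `F(ζ h ^ α (1 - u) ^ (-α))`, with `ζ = -lam₀`,
into the powers `(ζ h ^ α) ^ s (1 - u) ^ (-α s)`. On the lattice `h ℕ` the coefficients of
`h ^ a (1 - u) ^ (-a)`, divided by `h`, are `h ^ (a - 1) (a)ₙ / n!`; at `n = ⌊x / h⌋` they tend to
`x ^ (a - 1) / Γ(a)` when `x > 0`, whereas for `a = 0` all the mass `1` sits in the first cell and
produces `δ`. A Cauchy estimate on the circle of radius `1 - L h` bounds both the coefficients and
their limits by a multiple of `a x⁻¹ exp (2 L x) L ^ (-a)`. With `L = K + 1 / (4 x)` and a large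
constant `K` the bounds for `a = α s` are summable in `s` and locally integrable in `x`, so that
dominated convergence yields the limits for every superposition whose weights grow at most
geometrically in `s`. Both the coefficients `𝓔_α^(m)` and the state probabilities are of this form:
the Cauchy problem is a lower triangular Volterra equation, whose Picard iteration sums to
`p_n(t) = ∑ₘ (-ξ (lam + 1) t ^ β) ^ m / Γ(β m + 1) 𝓔_α^(m)(lam, n)`, because `𝓔_α^(m)(lam, ·)` is
the `m`-th convolution power of the entries `g_j`.
-/

namespace SpaceTimeML

/-- The coefficient `(a)ₙ / n!` of `u ^ n` in `(1 - u) ^ (-a)`. -/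
noncomputable def risingCoeff (a : ℝ) (n : ℕ) : ℝ :=
  (ascPochhammer ℝ n).eval a / (n.factorial : ℝ)

lemma risingCoeff_zero_right (a : ℝ) : risingCoeff a 0 = 1 := by simp [risingCoeff]

lemma risingCoeff_zero_left {n : ℕ} (hn : n ≠ 0) : risingCoeff 0 n = 0 := by
  simp [risingCoeff, hn]

lemma risingCoeff_nonneg {a : ℝ} (ha : 0 ≤ a) (n : ℕ) : 0 ≤ risingCoeff a n := by
  rcases ha.eq_or_lt with rfl | ha
  · rcases eq_or_ne n 0 with rfl | hn
    · simp [risingCoeff_zero_right]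
    · simp [risingCoeff_zero_left hn]
  · exact div_nonneg (ascPochhammer_pos n a ha).le (by positivity)

lemma succ_mul_risingCoeff_succ (a : ℝ) (n : ℕ) :
    ((n : ℝ) + 1) * risingCoeff a (n + 1) = (a + n) * risingCoeff a n := by
  have : (n.factorial : ℝ) ≠ 0 := by positivity
  rw [risingCoeff, risingCoeff, ascPochhammer_succ_eval, Nat.factorial_succ]
  push_cast
  field_simp

lemma natCast_mul_risingCoeff (a : ℝ) (n : ℕ) :
    (n : ℝ) * risingCoeff a n = a * ∑ k ∈ Finset.range n, risingCoeff a k := by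
  induction n with
  | zero => simp
  | succ n ih =>
    rw [Finset.sum_range_succ, mul_add, ← ih]
    push_cast
    rw [succ_mul_risingCoeff_succ]
    ring

lemma choose_add_sub_one_eq_ascPochhammer_div {R : Type*} [Field R] [CharZero R] (a : R) (n : ℕ) :
    Ring.choose (a + n - 1) n = (ascPochhammer R n).eval a / (n.factorial : R) := by
  have h : (n.factorial : R) ≠ 0 := Nat.cast_ne_zero.2 n.factorial_ne_zero
  have := Ring.factorial_nsmul_multichoose_eq_ascPochhammer a n
  rw [Polynomial.ascPochhammer_smeval_eq_eval, nsmul_eq_mul] at this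
  rw [eq_div_iff h, ← this, Ring.choose, show a + n - 1 - n + 1 = a by ring, mul_comm]

lemma hasSum_risingCoeff (a : ℝ) {u : ℝ} (hu : |u| < 1) :
    HasSum (fun n => risingCoeff a n * u ^ n) ((1 - u) ^ (-a)) := by
  have hu' : u ∈ Metric.eball (0 : ℝ) 1 := by
    simpa [← ENNReal.ofReal_one, Metric.eball_ofReal] using hu
  have := (Real.one_div_one_sub_rpow_hasFPowerSeriesOnBall_zero a).hasSum hu'
  have h0 : 0 ≤ 1 - u := by linarith [(abs_lt.1 hu).2]
  simpa [choose_add_sub_one_eq_ascPochhammer_div, risingCoeff, Real.rpow_neg h0, mul_comm]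
    using this

lemma hasSum_risingCoeff_natCast (m : ℕ) {z : ℂ} (hz : ‖z‖ < 1) :
    HasSum (fun n => (risingCoeff m n : ℂ) * z ^ n) (((1 - z) ^ m)⁻¹) := by
  have hz' : z ∈ Metric.eball (0 : ℂ) 1 := by
    simpa [← ENNReal.ofReal_one, Metric.eball_ofReal] using hz
  have := (Complex.one_div_one_sub_cpow_hasFPowerSeriesOnBall_zero m).hasSum hz'
  have hc (n : ℕ) : (risingCoeff m n : ℂ) = Ring.choose ((m : ℂ) + n - 1) n := by
    rw [risingCoeff, ← choose_add_sub_one_eq_ascPochhammer_div, Complex.ofReal_choose]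
    push_cast
    rfl
  simp_rw [hc]
  simpa [mul_comm] using this

lemma sum_risingCoeff_le {a r : ℝ} (ha : 0 ≤ a) (hr : 0 < r) (hr1 : r < 1) (n : ℕ) :
    ∑ k ∈ Finset.range (n + 1), risingCoeff a k ≤ (r ^ n)⁻¹ * (1 - r) ^ (-a) := by
  rw [inv_mul_eq_div, le_div_iff₀ (by positivity), Finset.sum_mul]
  calc ∑ k ∈ Finset.range (n + 1), risingCoeff a k * r ^ n
      ≤ ∑ k ∈ Finset.range (n + 1), risingCoeff a k * r ^ k :=
        Finset.sum_le_sum fun k hk => mul_le_mul_of_nonneg_left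
          (pow_le_pow_of_le_one hr.le hr1.le (Finset.mem_range_succ_iff.1 hk))
          (risingCoeff_nonneg ha k)
    _ ≤ (1 - r) ^ (-a) := sum_le_hasSum _
        (fun k _ => mul_nonneg (risingCoeff_nonneg ha k) (by positivity))
        (hasSum_risingCoeff a (by rwa [abs_of_pos hr]))

lemma risingCoeff_le {a r : ℝ} (ha : 0 ≤ a) (hr : 0 < r) (hr1 : r < 1) (n : ℕ) :
    risingCoeff a n ≤ (r ^ n)⁻¹ * (1 - r) ^ (-a) :=
  (Finset.single_le_sum (f := risingCoeff a) (fun k _ => risingCoeff_nonneg ha k)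
    (Finset.self_mem_range_succ n)).trans (sum_risingCoeff_le ha hr hr1 n)

lemma natCast_mul_risingCoeff_le {a r : ℝ} (ha : 0 ≤ a) (hr : 0 < r) (hr1 : r < 1) (n : ℕ) :
    n * risingCoeff a n ≤ a * ((r ^ n)⁻¹ * (1 - r) ^ (-a)) := by
  rw [natCast_mul_risingCoeff]
  refine mul_le_mul_of_nonneg_left (le_trans ?_ (sum_risingCoeff_le ha hr hr1 n)) ha
  exact Finset.sum_le_sum_of_subset_of_nonneg (Finset.range_subset_range.2 n.le_succ)
    fun k _ _ => risingCoeff_nonneg ha k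

lemma abs_risingCoeff_natCast_le (m s : ℕ) : |risingCoeff m s| ≤ 2 ^ m * 2 ^ s := by
  rw [abs_of_nonneg (risingCoeff_nonneg m.cast_nonneg s)]
  refine (risingCoeff_le (r := 1 / 2) m.cast_nonneg (by norm_num) (by norm_num) s).trans_eq ?_
  rw [show (1 : ℝ) - 1 / 2 = 2⁻¹ by norm_num, Real.inv_rpow (by norm_num),
    Real.rpow_neg (by norm_num), inv_inv, Real.rpow_natCast, one_div, inv_pow, inv_inv, mul_comm]

lemma tendsto_rpow_mul_risingCoeff {a : ℝ} (ha : 0 < a) :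
    Tendsto (fun n : ℕ => (n : ℝ) ^ (1 - a) * risingCoeff a n) atTop (𝓝 (Real.Gamma a)⁻¹) := by
  have h1 : Tendsto (fun n : ℕ => (n : ℝ) / (n + a)) atTop (𝓝 1) := tendsto_natCast_div_add_atTop a
  have h2 := h1.mul ((Real.GammaSeq_tendsto_Gamma a).inv₀ (Real.Gamma_pos_of_pos ha).ne')
  rw [one_mul] at h2
  refine h2.congr' ?_
  filter_upwards [eventually_gt_atTop 0] with n hn
  have hn' : (0 : ℝ) < n := by exact_mod_cast hn
  have hprod : ∏ j ∈ Finset.range (n + 1), (a + j) = (ascPochhammer ℝ n).eval a * (a + n) := by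
    rw [← ascPochhammer_succ_eval]
    induction n + 1 with
    | zero => simp
    | succ k ih => rw [Finset.prod_range_succ, ih, ascPochhammer_succ_eval]
  have hpoch := ascPochhammer_pos n a ha
  rw [Real.GammaSeq, hprod, risingCoeff, Real.rpow_sub hn', Real.rpow_one]
  field_simp
  ring

/-- The Riemann–Liouville kernel `x ^ (a - 1) / Γ(a)` on `[0, ∞)`, extended by `0` to `(-∞, 0)`. Its
value at `0` follows the convention `0 ^ 0 = 1`, so that `powerKernel 1` is the Heaviside
function. -/
noncomputable def powerKernel (a x : ℝ) : ℝ :=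
  if 0 ≤ x then x ^ (a - 1) / Real.Gamma a else 0

lemma powerKernel_of_neg (a : ℝ) {x : ℝ} (hx : x < 0) : powerKernel a x = 0 := if_neg hx.not_ge

lemma powerKernel_of_nonneg (a : ℝ) {x : ℝ} (hx : 0 ≤ x) :
    powerKernel a x = x ^ (a - 1) / Real.Gamma a := if_pos hx

lemma powerKernel_add_one_of_nonneg (a : ℝ) {x : ℝ} (hx : 0 ≤ x) :
    powerKernel (a + 1) x = x ^ a / Real.Gamma (a + 1) := by
  rw [powerKernel_of_nonneg _ hx, add_sub_cancel_right]

lemma powerKernel_one : powerKernel 1 = heaviside := by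
  ext x; simp [powerKernel, heaviside]

lemma powerKernel_nonneg {a : ℝ} (ha : 0 < a) (x : ℝ) : 0 ≤ powerKernel a x := by
  rw [powerKernel]
  split_ifs with hx
  · exact div_nonneg (Real.rpow_nonneg hx _) (Real.Gamma_pos_of_pos ha).le
  · rfl

lemma measurable_powerKernel (a : ℝ) : Measurable (powerKernel a) :=
  Measurable.ite measurableSet_Ici (by fun_prop) measurable_const

lemma mul_powerKernel_add_one {a x : ℝ} (ha : 0 < a) (hx : 0 < x) :
    a * powerKernel (a + 1) x = x * powerKernel a x := by
  rw [powerKernel_add_one_of_nonneg a hx.le, powerKernel_of_nonneg a hx.le,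
    Real.Gamma_add_one ha.ne', Real.rpow_sub_one hx.ne']
  have := Real.Gamma_pos_of_pos ha
  field_simp

lemma rpow_mul_exp_neg_le_Gamma {y a : ℝ} (hy : 0 ≤ y) (ha : 0 ≤ a) :
    y ^ a * Real.exp (-y) ≤ Real.Gamma (a + 1) := by
  have hinteg := Real.GammaIntegral_convergent (s := a + 1) (by linarith)
  have hsub : Ioi y ⊆ Ioi 0 := Ioi_subset_Ioi hy
  rw [Real.Gamma_eq_integral (by linarith), ← integral_exp_neg_Ioi y, ← integral_const_mul]
  refine (setIntegral_mono_on ((integrableOn_exp_neg_Ioi y).const_mul _)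
    (hinteg.mono_set hsub) measurableSet_Ioi fun x hx => ?_).trans
    (setIntegral_mono_set hinteg ?_ hsub.eventuallyLE)
  · rw [mul_comm, add_sub_cancel_right]
    exact mul_le_mul_of_nonneg_left (Real.rpow_le_rpow hy (le_of_lt hx) ha) (Real.exp_pos _).le
  · filter_upwards [ae_restrict_mem measurableSet_Ioi] with x hx
    exact mul_nonneg (Real.exp_pos _).le (Real.rpow_nonneg (le_of_lt hx) _)

lemma powerKernel_add_one_le {a L : ℝ} (ha : 0 ≤ a) (hL : 0 < L) {x : ℝ} (hx : 0 ≤ x) :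
    powerKernel (a + 1) x ≤ Real.exp (L * x) * L ^ (-a) := by
  have h := rpow_mul_exp_neg_le_Gamma (mul_nonneg hL.le hx) ha
  have hLa := Real.rpow_pos_of_pos hL a
  rw [Real.mul_rpow hL.le hx, Real.exp_neg, ← div_eq_mul_inv, div_le_iff₀ (Real.exp_pos _)] at h
  rw [powerKernel_add_one_of_nonneg a hx, div_le_iff₀ (Real.Gamma_pos_of_pos (by linarith)),
    Real.rpow_neg hL.le, mul_right_comm, ← div_eq_mul_inv, le_div_iff₀ hLa]
  linarith

lemma powerKernel_le {a L x : ℝ} (ha : 0 < a) (hL : 0 < L) (hx : 0 < x) :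
    powerKernel a x ≤ 2 * a / x * (Real.exp (2 * L * x) * L ^ (-a)) := by
  have hexp : Real.exp (L * x) ≤ Real.exp (2 * L * x) :=
    Real.exp_le_exp.2 (by nlinarith [mul_pos hL hx])
  calc powerKernel a x = a / x * powerKernel (a + 1) x := by
        rw [div_mul_eq_mul_div, mul_powerKernel_add_one ha hx, mul_div_cancel_left₀ _ hx.ne']
    _ ≤ a / x * (Real.exp (L * x) * L ^ (-a)) := by
        gcongr; exact powerKernel_add_one_le ha.le hL hx.le
    _ ≤ 2 * a / x * (Real.exp (2 * L * x) * L ^ (-a)) := by gcongr; linarith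

/-- The lattice counterpart `h ^ (a - 1) (a)ₙ / n!`, `n = ⌊x / h⌋`, of `powerKernel a x`: these are
the coefficients of `h ^ a (1 - u) ^ (-a)` divided by the lattice spacing. -/
noncomputable def latticePowerKernel (a h x : ℝ) : ℝ := h ^ (a - 1) * risingCoeff a ⌊x / h⌋₊

lemma latticePowerKernel_nonneg {a h : ℝ} (ha : 0 ≤ a) (hh : 0 ≤ h) (x : ℝ) :
    0 ≤ latticePowerKernel a h x :=
  mul_nonneg (Real.rpow_nonneg hh _) (risingCoeff_nonneg ha _)

lemma exp_neg_two_mul_le {y : ℝ} (h0 : 0 ≤ y) (h1 : y ≤ 1 / 2) : Real.exp (-(2 * y)) ≤ 1 - y := by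
  rw [Real.exp_neg, inv_le_comm₀ (Real.exp_pos _) (by linarith)]
  refine le_trans ?_ (Real.add_one_le_exp (2 * y))
  rw [inv_le_iff_one_le_mul₀ (by linarith)]
  nlinarith

lemma half_div_le_floor {h x : ℝ} (hh : 0 < h) (hx : h ≤ x) : x / (2 * h) ≤ ⌊x / h⌋₊ := by
  have h1 : 1 ≤ x / h := (one_le_div hh).2 hx
  have h2 : (1 : ℝ) ≤ ⌊x / h⌋₊ := by exact_mod_cast Nat.le_floor (by simpa using h1)
  have h3 := Nat.lt_floor_add_one (x / h)
  rw [mul_comm, ← div_div]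
  linarith

lemma inv_one_sub_pow_floor_le {L h x : ℝ} (hL : 0 ≤ L) (hh : 0 < h) (hx : 0 ≤ x)
    (hLh : L * h ≤ 1 / 2) : ((1 - L * h) ^ ⌊x / h⌋₊)⁻¹ ≤ Real.exp (2 * L * x) := by
  have hfloor : ⌊x / h⌋₊ * h ≤ x := by
    rw [← le_div_iff₀ hh]; exact Nat.floor_le (by positivity)
  refine (inv_anti₀ (by positivity) (pow_le_pow_left₀ (by positivity)
    (exp_neg_two_mul_le (by positivity) hLh) _)).trans ?_
  rw [← Real.exp_nat_mul, ← Real.exp_neg, Real.exp_le_exp]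
  nlinarith [mul_le_mul_of_nonneg_left hfloor hL]

/- Choosing the radius `r = 1 - L * h` turns the Cauchy estimate for `(1 - u) ^ (-a)` into the same
exponential bound as for the limit `powerKernel a`. -/
lemma latticePowerKernel_le {a L h x : ℝ} (ha : 0 < a) (hL : 0 < L) (hh : 0 < h) (hx : h ≤ x)
    (hLh : L * h ≤ 1 / 2) :
    latticePowerKernel a h x ≤ 2 * a / x * (Real.exp (2 * L * x) * L ^ (-a)) := by
  have hx0 : 0 < x := hh.trans_le hx
  have hLh0 : 0 < L * h := by positivity
  set n := ⌊x / h⌋₊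
  have hc := risingCoeff_nonneg ha.le n
  have hn : x / (2 * h) * risingCoeff a n ≤ n * risingCoeff a n :=
    mul_le_mul_of_nonneg_right (half_div_le_floor hh hx) hc
  have hcauchy := natCast_mul_risingCoeff_le ha.le (r := 1 - L * h) (by linarith) (by linarith) n
  have hexp := inv_one_sub_pow_floor_le hL.le hh hx0.le hLh
  have hha := Real.rpow_pos_of_pos hh a
  rw [sub_sub_cancel, Real.mul_rpow hL.le hh.le, Real.rpow_neg hh.le] at hcauchy
  calc latticePowerKernel a h x = 2 * h ^ a / x * (x / (2 * h) * risingCoeff a n) := by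
        rw [latticePowerKernel, Real.rpow_sub_one hh.ne']; field_simp; rfl
    _ ≤ 2 * h ^ a / x * (a * (Real.exp (2 * L * x) * (L ^ (-a) * (h ^ a)⁻¹))) := by
        refine mul_le_mul_of_nonneg_left (hn.trans (hcauchy.trans ?_)) (by positivity)
        gcongr
    _ = 2 * a / x * (Real.exp (2 * L * x) * L ^ (-a)) := by field_simp

lemma tendsto_latticePowerKernel {a x : ℝ} (ha : 0 < a) (hx : 0 < x) :
    Tendsto (fun h => latticePowerKernel a h x) (𝓝[>] 0) (𝓝 (powerKernel a x)) := by
  have hdiv : Tendsto (fun h : ℝ => x / h) (𝓝[>] 0) atTop := by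
    simpa only [div_eq_mul_inv] using tendsto_inv_nhdsGT_zero.const_mul_atTop hx
  have hfloor : Tendsto (fun h : ℝ => ⌊x / h⌋₊) (𝓝[>] 0) atTop := tendsto_nat_floor_atTop.comp hdiv
  have hratio : Tendsto (fun h : ℝ => (⌊x / h⌋₊ : ℝ) / (x / h)) (𝓝[>] 0) (𝓝 1) :=
    (tendsto_nat_floor_div_atTop (R := ℝ)).comp hdiv
  have hlim := ((hratio.rpow_const (p := a - 1) (Or.inl one_ne_zero)).const_mul (x ^ (a - 1))).mul
    ((tendsto_rpow_mul_risingCoeff ha).comp hfloor)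
  rw [Real.one_rpow, mul_one, ← div_eq_mul_inv, ← powerKernel_of_nonneg a hx.le] at hlim
  refine hlim.congr' ?_
  filter_upwards [self_mem_nhdsWithin, hfloor.eventually_gt_atTop 0] with h (hh : 0 < h) hn
  have hn' : (0 : ℝ) < ⌊x / h⌋₊ := by exact_mod_cast hn
  rw [latticePowerKernel, Function.comp_apply, Real.div_rpow hn'.le (by positivity),
    Real.div_rpow hx.le hh.le, show 1 - a = -(a - 1) by ring, Real.rpow_neg hn'.le]
  field_simp

lemma natCast_succ_le_two_pow (s : ℕ) : (s : ℝ) + 1 ≤ 2 ^ (s + 1) := by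
  exact_mod_cast (Nat.lt_two_pow_self (n := s + 1)).le

/-- A rate `K` at which `∑ₛ (2 ζ) ^ s x ^ (α s) / Γ(α s + 1)` is `O(exp (K x))`, normalised by
`4 |ζ| K ^ (-α) ≤ 1 / 2`. -/
noncomputable def growthRate (α ζ : ℝ) : ℝ := (8 * |ζ| + 1) ^ α⁻¹

/-- A locally integrable majorant of `∑ₛ (2 ζ) ^ s x ^ (α s - 1) / Γ(α s)`, `s ≥ 1`, and of the
lattice approximations of this function. -/
noncomputable def densityMajorant (α ζ x : ℝ) : ℝ :=
  8 * α * |ζ| * 4 ^ α * Real.exp (2 * growthRate α ζ * x + 1 / 2) * x ^ (α - 1)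

section Majorants

variable {α : ℝ}

lemma growthRate_pos (α ζ : ℝ) : 0 < growthRate α ζ := by unfold growthRate; positivity

lemma growthRate_le (hα : 0 < α) (ζ : ℝ) : 4 * |ζ| * growthRate α ζ ^ (-α) ≤ 1 / 2 := by
  rw [growthRate, ← Real.rpow_mul (by positivity), mul_neg, inv_mul_cancel₀ hα.ne',
    Real.rpow_neg_one, ← div_eq_mul_inv, div_le_iff₀ (by positivity)]
  linarith

lemma densityMajorant_nonneg (hα : 0 ≤ α) (ζ : ℝ) {x : ℝ} (hx : 0 ≤ x) :
    0 ≤ densityMajorant α ζ x := by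
  unfold densityMajorant; positivity

lemma integrableOn_densityMajorant (hα : 0 < α) (ζ R : ℝ) :
    IntegrableOn (densityMajorant α ζ) (Ioc 0 R) := by
  have hpow : IntegrableOn (fun x : ℝ => x ^ (α - 1)) (Ioc 0 R) :=
    (intervalIntegral.intervalIntegrable_rpow' (by linarith)).1
  have hexp : Continuous fun x : ℝ =>
      8 * α * |ζ| * 4 ^ α * Real.exp (2 * growthRate α ζ * x + 1 / 2) := by fun_prop
  exact hpow.continuousOn_mul_of_subset hexp.continuousOn isCompact_Icc measurableSet_Ioc
    Ioc_subset_Icc_self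

/- At `L = growthRate α ζ + 1 / (4 x)` the bounds for the kernels of order `α (s + 1)` decay
geometrically in `s`, thanks to the first summand, and are integrable at `x = 0`, thanks to the
second. -/
lemma geometric_le_densityMajorant (hα : 0 < α) (ζ : ℝ) {x : ℝ} (hx : 0 < x) (s : ℕ) {L : ℝ}
    (hL : L = growthRate α ζ + 1 / (4 * x)) :
    2 ^ (s + 1) * |ζ| ^ (s + 1) *
        (2 * (α * (s + 1)) / x * (Real.exp (2 * L * x) * L ^ (-(α * (s + 1))))) ≤
      densityMajorant α ζ x * (1 / 2) ^ s := by
  have hK := growthRate_pos α ζ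
  set K := growthRate α ζ with hKdef
  have hL0 : 0 < L := by rw [hL]; positivity
  have hLK : L ^ (-α) ≤ K ^ (-α) :=
    Real.rpow_le_rpow_of_nonpos hK (by rw [hL, le_add_iff_nonneg_right]; positivity) (by linarith)
  have hLx : L ^ (-α) ≤ 4 ^ α * x ^ α := by
    rw [← Real.mul_rpow (by norm_num) hx.le]
    refine (Real.rpow_le_rpow_of_nonpos (x := (4 * x)⁻¹) (by positivity)
      (by rw [hL, one_div]; linarith) (by linarith)).trans_eq ?_
    rw [Real.inv_rpow (by positivity), Real.rpow_neg (by positivity), inv_inv]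
  have hLpow : L ^ (-(α * (s + 1))) = (L ^ (-α)) ^ (s + 1) := by
    rw [← Real.rpow_natCast, ← Real.rpow_mul hL0.le]; push_cast; ring_nf
  have hgeom : (4 * |ζ| * L ^ (-α)) ^ (s + 1) ≤ (1 / 2) ^ s * (4 * |ζ| * (4 ^ α * x ^ α)) := by
    rw [pow_succ]
    gcongr
    exact (mul_le_mul_of_nonneg_left hLK (by positivity)).trans (growthRate_le hα ζ)
  calc _ ≤ 2 ^ (s + 1) * |ζ| ^ (s + 1) *
        (2 * (α * 2 ^ (s + 1)) / x * (Real.exp (2 * L * x) * (L ^ (-α)) ^ (s + 1))) := by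
        rw [hLpow]; gcongr; exact natCast_succ_le_two_pow s
    _ = 2 * α / x * Real.exp (2 * L * x) * (4 * |ζ| * L ^ (-α)) ^ (s + 1) := by
        rw [show (4 : ℝ) = 2 * 2 by norm_num]; simp only [mul_pow]; ring
    _ ≤ 2 * α / x * Real.exp (2 * L * x) * ((1 / 2) ^ s * (4 * |ζ| * (4 ^ α * x ^ α))) := by
        gcongr
    _ = densityMajorant α ζ x * (1 / 2) ^ s := by
        rw [densityMajorant, ← hKdef, Real.rpow_sub_one hx.ne',
          show 2 * L * x = 2 * K * x + 1 / 2 by rw [hL]; field_simp; ring]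
        ring

lemma two_pow_mul_abs_powerKernel_le (hα : 0 < α) (ζ : ℝ) {x : ℝ} (hx : 0 < x) (s : ℕ) :
    2 ^ (s + 1) * |ζ ^ (s + 1) * powerKernel (α * (s + 1)) x| ≤
      densityMajorant α ζ x * (1 / 2) ^ s := by
  have hK := growthRate_pos α ζ
  refine le_trans ?_ (geometric_le_densityMajorant hα ζ hx s rfl)
  rw [abs_mul, abs_pow, abs_of_nonneg (powerKernel_nonneg (by positivity) x), ← mul_assoc]
  gcongr
  exact powerKernel_le (by positivity) (by positivity) hx

lemma two_pow_mul_abs_latticePowerKernel_le (hα : 0 < α) (ζ : ℝ) {h x : ℝ} (hh : 0 < h)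
    (hx : h ≤ x) (hKh : 4 * growthRate α ζ * h ≤ 1) (s : ℕ) :
    2 ^ (s + 1) * |ζ ^ (s + 1) * latticePowerKernel (α * (s + 1)) h x| ≤
      densityMajorant α ζ x * (1 / 2) ^ s := by
  have hx0 : 0 < x := hh.trans_le hx
  have hK := growthRate_pos α ζ
  have hquarter : 1 / (4 * x) * h ≤ 1 / 4 := by
    rw [div_mul_eq_mul_div, div_le_iff₀ (by positivity)]; linarith
  refine le_trans ?_ (geometric_le_densityMajorant hα ζ hx0 s rfl)
  rw [abs_mul, abs_pow, abs_of_nonneg (latticePowerKernel_nonneg (by positivity) hh.le x),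
    ← mul_assoc]
  gcongr
  exact latticePowerKernel_le (by positivity) (by positivity) hh hx (by linarith)

lemma two_pow_mul_abs_powerKernel_add_one_le (hα : 0 < α) (ζ : ℝ) {x : ℝ} (hx : 0 ≤ x) (s : ℕ) :
    2 ^ s * |ζ ^ s * powerKernel (α * s + 1) x| ≤ Real.exp (growthRate α ζ * x) * (1 / 2) ^ s := by
  have hK := growthRate_pos α ζ
  have hbound := powerKernel_add_one_le (a := α * s) (by positivity) hK hx
  have hKpow : growthRate α ζ ^ (-(α * s)) = (growthRate α ζ ^ (-α)) ^ s := by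
    rw [← Real.rpow_natCast, ← Real.rpow_mul hK.le]; ring_nf
  have hrate := growthRate_le hα ζ
  rw [abs_mul, abs_pow, abs_of_nonneg (powerKernel_nonneg (by positivity) x)]
  calc _ ≤ 2 ^ s * (|ζ| ^ s *
        (Real.exp (growthRate α ζ * x) * (growthRate α ζ ^ (-α)) ^ s)) := by
        rw [← hKpow]; gcongr
    _ = Real.exp (growthRate α ζ * x) * (2 * |ζ| * growthRate α ζ ^ (-α)) ^ s := by
        simp only [mul_pow]; ring
    _ ≤ _ := by
        have : 0 ≤ |ζ| * growthRate α ζ ^ (-α) := by positivity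
        gcongr
        linarith

lemma summable_abs_two_mul_pow_div_Gamma (hα : 0 < α) (z : ℝ) :
    Summable fun m : ℕ => 2 ^ m * |z ^ m / Real.Gamma (α * m + 1)| := by
  refine Summable.of_nonneg_of_le (fun m => by positivity) (fun m => ?_)
    (summable_geometric_two.mul_left (Real.exp (growthRate α z * 1)))
  simpa only [powerKernel_add_one_of_nonneg _ zero_le_one, Real.one_rpow, mul_one_div] using
    two_pow_mul_abs_powerKernel_add_one_le hα z zero_le_one m

end Majorants

/-- A causal function: it vanishes on `(-∞, 0)` and is integrable up to every finite horizon, so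
that it defines a regular distribution supported on the half-line. -/
structure IsCausal (f : ℝ → ℝ) : Prop where
  eq_zero_of_neg : ∀ x < 0, f x = 0
  integrableOn : ∀ R : ℝ, IntegrableOn f (Ioc 0 R)

namespace IsCausal

variable {f : ℝ → ℝ}

lemma const_mul (hf : IsCausal f) (c : ℝ) : IsCausal fun x => c * f x where
  eq_zero_of_neg x hx := by rw [hf.eq_zero_of_neg x hx, mul_zero]
  integrableOn R := (hf.integrableOn R).const_mul c

lemma locallyIntegrable (hf : IsCausal f) : LocallyIntegrable f := by
  rw [locallyIntegrable_iff]
  intro k hk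
  obtain ⟨R, hR⟩ := hk.isBounded.subset_closedBall 0
  have hneg : IntegrableOn f (Iio 0) :=
    (integrableOn_congr_fun hf.eq_zero_of_neg measurableSet_Iio).2 integrableOn_zero
  have hnonpos : IntegrableOn f (Iic 0) :=
    (integrableOn_Iic_iff_integrableOn_Iio (by simp)).2 hneg
  refine (hnonpos.union (hf.integrableOn R)).mono_set fun x hx => ?_
  have hxR := hR hx
  rw [mem_closedBall_zero_iff, Real.norm_eq_abs, abs_le] at hxR
  exact (le_or_gt x 0).imp id fun h => ⟨h, hxR.2⟩

lemma regularDist_apply (hf : IsCausal f) {φ : 𝓓((⊤ : Opens ℝ), ℝ)} {R : ℝ}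
    (hR : ∀ x, R < x → φ x = 0) : regularDist f φ = ∫ x in Ioc 0 R, φ x * f x := by
  have hfull : regularDist f φ = ∫ x, φ x * f x :=
    TestFunction.integralAgainstBilinCLM_eq_integral (hf.locallyIntegrable.locallyIntegrableOn _)
  rw [hfull, ← integral_Icc_eq_integral_Ioc]
  refine (setIntegral_eq_integral_of_forall_compl_eq_zero fun x hx => ?_).symm
  rcases lt_or_ge x 0 with h | h
  · rw [hf.eq_zero_of_neg x h, mul_zero]
  · rw [hR x (not_le.1 fun h' => hx ⟨h, h'⟩), zero_mul]

end IsCausal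

lemma exists_pos_forall_lt_eq_zero (φ : 𝓓((⊤ : Opens ℝ), ℝ)) :
    ∃ R > 0, ∀ x, R < x → φ x = 0 := by
  obtain ⟨R, hR⟩ := φ.hasCompactSupport.isCompact.isBounded.subset_closedBall 0
  refine ⟨max R 1, by positivity, fun x hx => ?_⟩
  by_contra h
  have := hR (subset_tsupport _ h)
  rw [mem_closedBall_zero_iff, Real.norm_eq_abs] at this
  linarith [le_abs_self x, le_max_left R 1]

lemma exists_forall_abs_le (φ : 𝓓((⊤ : Opens ℝ), ℝ)) : ∃ M ≥ 0, ∀ x, |φ x| ≤ M := by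
  obtain ⟨M, hM⟩ := φ.continuous.bounded_above_of_compact_support φ.hasCompactSupport
  exact ⟨M, (norm_nonneg _).trans (hM 0), hM⟩

lemma hasDerivAt_testFunction (φ : 𝓓((⊤ : Opens ℝ), ℝ)) (x : ℝ) :
    HasDerivAt φ ((∂_{(1 : ℝ)} φ : 𝓓((⊤ : Opens ℝ), ℝ)) x) x := by
  have h : (∂_{(1 : ℝ)} φ : 𝓓((⊤ : Opens ℝ), ℝ)) x = deriv φ x := by
    rw [TestFunction.lineDerivOp_eq_lineDerivCLM ℝ, TestFunction.lineDerivCLM_apply_of_le (by simp),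
      lineDeriv, show (fun t : ℝ => φ (x + t • (1 : ℝ))) = fun t => φ (x + t) by simp,
      deriv_comp_const_add, add_zero]
  rw [h]
  exact (φ.contDiff.differentiable (by simp)).differentiableAt.hasDerivAt

lemma IsCausal.regularDist_congr {f g : ℝ → ℝ} (hf : IsCausal f) (h : ∀ x, x ≠ 0 → f x = g x) :
    regularDist f = regularDist g := by
  have hpos {R : ℝ} : EqOn f g (Ioc 0 R) := fun x hx => h x hx.1.ne'
  have hg : IsCausal g :=
    ⟨fun x hx => (h x hx.ne).symm.trans (hf.eq_zero_of_neg x hx),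
      fun R => (integrableOn_congr_fun hpos measurableSet_Ioc).1 (hf.integrableOn R)⟩
  ext φ
  obtain ⟨R, -, hR⟩ := exists_pos_forall_lt_eq_zero φ
  rw [hf.regularDist_apply hR, hg.regularDist_apply hR]
  exact setIntegral_congr_fun measurableSet_Ioc fun x hx => congrArg (φ x * ·) (hpos hx)

lemma IsCausal.regularDist_const_mul {f : ℝ → ℝ} (hf : IsCausal f) (c : ℝ)
    (φ : 𝓓((⊤ : Opens ℝ), ℝ)) : regularDist (fun x => c * f x) φ = c * regularDist f φ := by
  obtain ⟨R, -, hR⟩ := exists_pos_forall_lt_eq_zero φ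
  rw [(hf.const_mul c).regularDist_apply hR, hf.regularDist_apply hR, ← integral_const_mul]
  simp only [mul_left_comm]

section Series

variable {f : ℕ → ℝ → ℝ} {F g : ℝ → ℝ} {A : ℕ → ℝ}

lemma IsCausal.of_hasSum (hf : ∀ m, IsCausal (f m)) (hg : ∀ R, IntegrableOn g (Ioc 0 R))
    (hA : Summable A) (hle : ∀ m x, 0 < x → |f m x| ≤ A m * g x)
    (hF : ∀ x, 0 < x → HasSum (fun m => f m x) (F x)) (hF0 : ∀ x < 0, F x = 0) : IsCausal F where
  eq_zero_of_neg := hF0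
  integrableOn R := by
    have hmeas : AEStronglyMeasurable F (volume.restrict (Ioc 0 R)) := by
      refine aestronglyMeasurable_of_tendsto_ae atTop
        (f := fun N x => ∑ m ∈ Finset.range N, f m x) (fun N => ?_) ?_
      · exact Finset.aestronglyMeasurable_fun_sum _ fun m _ =>
          ((hf m).integrableOn R).aestronglyMeasurable
      · filter_upwards [ae_restrict_mem measurableSet_Ioc] with x hx
        exact (hF x hx.1).tendsto_sum_nat
    refine Integrable.mono' ((hg R).const_mul (∑' m, A m)) hmeas ?_
    filter_upwards [ae_restrict_mem measurableSet_Ioc] with x hx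
    exact (hF x hx.1).norm_le_of_bounded (hA.hasSum.mul_right (g x)) fun m => hle m x hx.1

lemma hasSum_regularDist (hf : ∀ m, IsCausal (f m)) (hg : ∀ R, IntegrableOn g (Ioc 0 R))
    (hA : Summable A) (hle : ∀ m x, 0 < x → |f m x| ≤ A m * g x)
    (hF : ∀ x, 0 < x → HasSum (fun m => f m x) (F x)) (hF0 : ∀ x < 0, F x = 0)
    (φ : 𝓓((⊤ : Opens ℝ), ℝ)) :
    HasSum (fun m => regularDist (f m) φ) (regularDist F φ) := by
  obtain ⟨R, -, hR⟩ := exists_pos_forall_lt_eq_zero φ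
  obtain ⟨M, hM0, hM⟩ := exists_forall_abs_le φ
  have hFc := IsCausal.of_hasSum hf hg hA hle hF hF0
  have hinteg (m : ℕ) : IntegrableOn (fun x => φ x * f m x) (Ioc 0 R) :=
    ((hf m).integrableOn R).bdd_mul φ.continuous.aestronglyMeasurable
      (Eventually.of_forall hM)
  have hnorm (m : ℕ) : ∫ x in Ioc 0 R, ‖φ x * f m x‖ ≤ A m * ∫ x in Ioc 0 R, M * g x := by
    rw [← integral_const_mul]
    refine setIntegral_mono_on (hinteg m).norm (((hg R).const_mul M).const_mul (A m))
      measurableSet_Ioc fun x hx => ?_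
    rw [norm_mul, mul_left_comm]
    exact mul_le_mul (hM x) (hle m x hx.1) (abs_nonneg _) hM0
  have hsum := hasSum_integral_of_summable_integral_norm hinteg <|
    (hA.mul_right _).of_nonneg_of_le (fun m => integral_nonneg fun x => norm_nonneg _) hnorm
  have htsum : ∫ x in Ioc 0 R, φ x * F x = ∫ x in Ioc 0 R, ∑' m, φ x * f m x :=
    setIntegral_congr_fun measurableSet_Ioc fun x hx => by
      simp only [tsum_mul_left, (hF x hx.1).tsum_eq]
  rw [hFc.regularDist_apply hR, htsum]
  simpa only [(hf _).regularDist_apply hR] using hsum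

end Series

lemma isCausal_powerKernel {a : ℝ} (ha : 0 < a) : IsCausal (powerKernel a) where
  eq_zero_of_neg _ := powerKernel_of_neg a
  integrableOn R := by
    have hpow : IntegrableOn (fun x : ℝ => x ^ (a - 1)) (Ioc 0 R) :=
      (intervalIntegral.intervalIntegrable_rpow' (by linarith)).1
    exact (integrableOn_congr_fun
      (fun x (hx : x ∈ Ioc 0 R) => powerKernel_of_nonneg a hx.1.le) measurableSet_Ioc).2
      (hpow.div_const _)

/- The jump of `F` at `0` is the only contribution beyond its classical derivative. -/
lemma lineDeriv_regularDist {F f : ℝ → ℝ} (hF : IsCausal F) (hf : IsCausal f)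
    (hcont : ContinuousOn F (Ici 0)) (hderiv : ∀ x, 0 < x → HasDerivAt F (f x) x)
    (φ : 𝓓((⊤ : Opens ℝ), ℝ)) :
    (∂_{(1 : ℝ)} (regularDist F) : 𝓓'((⊤ : Opens ℝ), ℝ)) φ = F 0 * φ 0 + regularDist f φ := by
  set ψ : 𝓓((⊤ : Opens ℝ), ℝ) := ∂_{(1 : ℝ)} φ with hψ
  obtain ⟨R₁, hR₁0, hR₁⟩ := exists_pos_forall_lt_eq_zero φ
  obtain ⟨R₂, hR₂0, hR₂⟩ := exists_pos_forall_lt_eq_zero ψ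
  set R := R₁ + R₂
  have hR0 : 0 ≤ R := by positivity
  have hφR : φ R = 0 := hR₁ R (by linarith)
  have hparts := intervalIntegral.integral_mul_deriv_eq_deriv_mul_of_hasDerivAt (a := 0) (b := R)
    (u := F) (v := φ) (u' := f) (v' := ψ)
    (hcont.mono (by rw [uIcc_of_le hR0]; exact Icc_subset_Ici_self)) φ.continuous.continuousOn
    (fun x hx => hderiv x (by simpa [hR0] using hx.1))
    (fun x _ => hasDerivAt_testFunction φ x)
    ((intervalIntegrable_iff_integrableOn_Ioc_of_le hR0).2 (hf.integrableOn R))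
    (ψ.continuous.intervalIntegrable _ _)
  rw [intervalIntegral.integral_of_le hR0, intervalIntegral.integral_of_le hR0, hφR] at hparts
  rw [Distribution.lineDerivOp_apply_apply, map_neg, ← hψ,
    hF.regularDist_apply (R := R) fun x hx => hR₂ x (by linarith),
    hf.regularDist_apply (R := R) fun x hx => hR₁ x (by linarith)]
  simp only [mul_comm (ψ _), mul_comm (φ _), hparts]
  ring

lemma continuousOn_powerKernel_add_one {a : ℝ} (ha : 0 ≤ a) :
    ContinuousOn (powerKernel (a + 1)) (Ici 0) :=
  ((Real.continuous_rpow_const ha).div_const _).continuousOn.congr fun _ hx =>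
    powerKernel_add_one_of_nonneg a hx

lemma hasDerivAt_powerKernel_add_one {a x : ℝ} (ha : 0 < a) (hx : 0 < x) :
    HasDerivAt (powerKernel (a + 1)) (powerKernel a x) x := by
  have h := (Real.hasDerivAt_rpow_const (p := a) (Or.inl hx.ne')).div_const (Real.Gamma (a + 1))
  rw [Real.Gamma_add_one ha.ne', mul_div_mul_left _ _ ha.ne', ← Real.Gamma_add_one ha.ne',
    ← powerKernel_of_nonneg a hx.le] at h
  refine h.congr_of_eventuallyEq ?_
  filter_upwards [lt_mem_nhds hx] with y hy using powerKernel_add_one_of_nonneg a hy.le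

lemma lineDeriv_regularDist_powerKernel_add_one {a : ℝ} (ha : 0 < a) (φ : 𝓓((⊤ : Opens ℝ), ℝ)) :
    (∂_{(1 : ℝ)} (regularDist (powerKernel (a + 1))) : 𝓓'((⊤ : Opens ℝ), ℝ)) φ =
      regularDist (powerKernel a) φ := by
  rw [lineDeriv_regularDist (isCausal_powerKernel (by linarith)) (isCausal_powerKernel ha)
    (continuousOn_powerKernel_add_one ha.le) fun x hx => hasDerivAt_powerKernel_add_one ha hx,
    powerKernel_add_one_of_nonneg a le_rfl, Real.zero_rpow ha.ne', zero_div, zero_mul, zero_add]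

lemma lineDeriv_regularDist_powerKernel_one (φ : 𝓓((⊤ : Opens ℝ), ℝ)) :
    (∂_{(1 : ℝ)} (regularDist (powerKernel 1)) : 𝓓'((⊤ : Opens ℝ), ℝ)) φ = φ 0 := by
  have hzero : IsCausal fun _ => (0 : ℝ) := ⟨fun _ _ => rfl, fun _ => integrableOn_zero⟩
  have hone {x : ℝ} (hx : 0 ≤ x) : powerKernel 1 x = 1 := by simp [powerKernel_of_nonneg 1 hx]
  have hderiv (x : ℝ) (hx : 0 < x) : HasDerivAt (powerKernel 1) 0 x := by
    refine (hasDerivAt_const x (1 : ℝ)).congr_of_eventuallyEq ?_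
    filter_upwards [lt_mem_nhds hx] with y hy using hone hy.le
  obtain ⟨R, -, hR⟩ := exists_pos_forall_lt_eq_zero φ
  rw [lineDeriv_regularDist (isCausal_powerKernel one_pos) hzero
    (continuousOn_const.congr fun x hx => hone hx) hderiv, hone le_rfl, hzero.regularDist_apply hR]
  simp

/-- The density `∑ₛ c_{s+1} ζ ^ (s + 1) x ^ (α (s + 1) - 1) / Γ(α (s + 1))` on `x > 0` with weights
`c`, the Prabhakar density being the case `c s = (γ)ₛ / s!`. -/
noncomputable def kernelDensity (α : ℝ) (c : ℕ → ℝ) (ζ x : ℝ) : ℝ :=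
  ∑' s : ℕ, c (s + 1) * (ζ ^ (s + 1) * powerKernel (α * (s + 1)) x)

/-- The primitive `Θ(x) ∑ₛ c_s (ζ x ^ α) ^ s / Γ(α s + 1)` of the kernel with weights `c`. -/
noncomputable def kernelPrimitive (α : ℝ) (c : ℕ → ℝ) (ζ x : ℝ) : ℝ :=
  ∑' s : ℕ, c s * (ζ ^ s * powerKernel (α * s + 1) x)

/-- The distribution `∑ₛ c_s ζ ^ s x ^ (α s - 1) / Γ(α s)`, in which the term `s = 0` stands for
`c₀ δ`. -/
noncomputable def seriesKernel (α : ℝ) (c : ℕ → ℝ) (ζ : ℝ) : 𝓓'((⊤ : Opens ℝ), ℝ) :=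
  c 0 • Distribution.delta 0 + regularDist (kernelDensity α c ζ)

lemma seriesKernel_apply (α : ℝ) (c : ℕ → ℝ) (ζ : ℝ) (φ : 𝓓((⊤ : Opens ℝ), ℝ)) :
    seriesKernel α c ζ φ = c 0 * φ 0 + regularDist (kernelDensity α c ζ) φ := by
  rw [← Distribution.delta_apply]; rfl

section SeriesKernel

variable {α C : ℝ} {c : ℕ → ℝ}

lemma nonneg_of_abs_le_two_pow (hc : ∀ s, |c s| ≤ C * 2 ^ s) : 0 ≤ C := by
  simpa using (abs_nonneg _).trans (hc 0)

lemma abs_mul_le_of_two_pow (hc : ∀ s, |c s| ≤ C * 2 ^ s) {s : ℕ} {w B : ℝ}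
    (hw : 2 ^ s * |w| ≤ B) : |c s * w| ≤ C * B := by
  rw [abs_mul]
  calc |c s| * |w| ≤ C * 2 ^ s * |w| := by gcongr; exact hc s
    _ = C * (2 ^ s * |w|) := by ring
    _ ≤ C * B := mul_le_mul_of_nonneg_left hw (nonneg_of_abs_le_two_pow hc)

lemma abs_kernelDensity_term_le (hα : 0 < α) (ζ : ℝ) (hc : ∀ s, |c s| ≤ C * 2 ^ s) (s : ℕ) {x : ℝ}
    (hx : 0 < x) :
    |c (s + 1) * (ζ ^ (s + 1) * powerKernel (α * (s + 1)) x)| ≤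
      C * (densityMajorant α ζ x * (1 / 2) ^ s) :=
  abs_mul_le_of_two_pow hc (two_pow_mul_abs_powerKernel_le hα ζ hx s)

lemma abs_kernelPrimitive_term_le (hα : 0 < α) (ζ : ℝ) (hc : ∀ s, |c s| ≤ C * 2 ^ s) (s : ℕ) {x : ℝ}
    (hx : 0 ≤ x) :
    |c s * (ζ ^ s * powerKernel (α * s + 1) x)| ≤
      C * (Real.exp (growthRate α ζ * x) * (1 / 2) ^ s) :=
  abs_mul_le_of_two_pow hc (two_pow_mul_abs_powerKernel_add_one_le hα ζ hx s)

lemma hasSum_kernelDensity (hα : 0 < α) (ζ : ℝ) (hc : ∀ s, |c s| ≤ C * 2 ^ s) {x : ℝ} (hx : 0 < x) :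
    HasSum (fun s : ℕ => c (s + 1) * (ζ ^ (s + 1) * powerKernel (α * (s + 1)) x))
      (kernelDensity α c ζ x) :=
  (Summable.of_norm_bounded ((summable_geometric_two.mul_left _).mul_left C)
    fun s => abs_kernelDensity_term_le hα ζ hc s hx).hasSum

lemma hasSum_kernelPrimitive (hα : 0 < α) (ζ : ℝ) (hc : ∀ s, |c s| ≤ C * 2 ^ s) {x : ℝ}
    (hx : 0 ≤ x) :
    HasSum (fun s : ℕ => c s * (ζ ^ s * powerKernel (α * s + 1) x)) (kernelPrimitive α c ζ x) :=
  (Summable.of_norm_bounded ((summable_geometric_two.mul_left _).mul_left C)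
    fun s => abs_kernelPrimitive_term_le hα ζ hc s hx).hasSum

lemma kernelDensity_of_neg (α : ℝ) (c : ℕ → ℝ) (ζ : ℝ) {x : ℝ} (hx : x < 0) :
    kernelDensity α c ζ x = 0 := by
  simp [kernelDensity, powerKernel_of_neg _ hx]

lemma kernelPrimitive_of_neg (α : ℝ) (c : ℕ → ℝ) (ζ : ℝ) {x : ℝ} (hx : x < 0) :
    kernelPrimitive α c ζ x = 0 := by
  simp [kernelPrimitive, powerKernel_of_neg _ hx]

lemma abs_kernelDensity_le (hα : 0 < α) (ζ : ℝ) (hc : ∀ s, |c s| ≤ C * 2 ^ s) {x : ℝ} (hx : 0 < x) :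
    |kernelDensity α c ζ x| ≤ C * (densityMajorant α ζ x * 2) :=
  (hasSum_kernelDensity hα ζ hc hx).norm_le_of_bounded
    ((hasSum_geometric_two.mul_left _).mul_left C)
    fun s => abs_kernelDensity_term_le hα ζ hc s hx

lemma isCausal_powerKernel_term (ζ b : ℝ) (s : ℕ) {a : ℝ} (ha : 0 < a) :
    IsCausal fun x => b * (ζ ^ s * powerKernel a x) :=
  ((isCausal_powerKernel ha).const_mul _).const_mul _

lemma isCausal_kernelDensity (hα : 0 < α) (ζ : ℝ) (hc : ∀ s, |c s| ≤ C * 2 ^ s) :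
    IsCausal (kernelDensity α c ζ) :=
  .of_hasSum (fun s => isCausal_powerKernel_term ζ (c (s + 1)) (s + 1) (by positivity))
    (fun R => (integrableOn_densityMajorant hα ζ R).const_mul C) summable_geometric_two
    (fun s x hx => (abs_kernelDensity_term_le hα ζ hc s hx).trans_eq (by ring))
    (fun x hx => hasSum_kernelDensity hα ζ hc hx) fun x hx => kernelDensity_of_neg α c ζ hx

lemma hasSum_regularDist_kernelDensity (hα : 0 < α) (ζ : ℝ) (hc : ∀ s, |c s| ≤ C * 2 ^ s)
    (φ : 𝓓((⊤ : Opens ℝ), ℝ)) :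
    HasSum (fun s : ℕ => c (s + 1) * (ζ ^ (s + 1) * regularDist (powerKernel (α * (s + 1))) φ))
      (regularDist (kernelDensity α c ζ) φ) := by
  refine (hasSum_regularDist
    (fun s => isCausal_powerKernel_term ζ (c (s + 1)) (s + 1) (by positivity))
    (fun R => (integrableOn_densityMajorant hα ζ R).const_mul C) summable_geometric_two
    (fun s x hx => (abs_kernelDensity_term_le hα ζ hc s hx).trans_eq (by ring))
    (fun x hx => hasSum_kernelDensity hα ζ hc hx)
    (fun x hx => kernelDensity_of_neg α c ζ hx) φ).congr_fun fun s => ?_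
  have hcausal := isCausal_powerKernel (a := α * (s + 1)) (by positivity)
  rw [(hcausal.const_mul _).regularDist_const_mul, hcausal.regularDist_const_mul]

lemma hasSum_regularDist_kernelPrimitive (hα : 0 < α) (ζ : ℝ) (hc : ∀ s, |c s| ≤ C * 2 ^ s)
    (φ : 𝓓((⊤ : Opens ℝ), ℝ)) :
    HasSum (fun s : ℕ => c s * (ζ ^ s * regularDist (powerKernel (α * s + 1)) φ))
      (regularDist (kernelPrimitive α c ζ) φ) := by
  refine (hasSum_regularDist (g := fun x => C * Real.exp (growthRate α ζ * x))
    (fun s => isCausal_powerKernel_term ζ (c s) s (by positivity))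
    (fun R => Continuous.integrableOn_Ioc (by fun_prop)) summable_geometric_two
    (fun s x hx => (abs_kernelPrimitive_term_le hα ζ hc s hx.le).trans_eq (by ring))
    (fun x hx => hasSum_kernelPrimitive hα ζ hc hx.le)
    (fun x hx => kernelPrimitive_of_neg α c ζ hx) φ).congr_fun fun s => ?_
  have hcausal := isCausal_powerKernel (a := α * s + 1) (by positivity)
  rw [(hcausal.const_mul _).regularDist_const_mul, hcausal.regularDist_const_mul]

theorem lineDeriv_regularDist_kernelPrimitive (hα : 0 < α) (ζ : ℝ)
    (hc : ∀ s, |c s| ≤ C * 2 ^ s) :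
    (∂_{(1 : ℝ)} (regularDist (kernelPrimitive α c ζ)) : 𝓓'((⊤ : Opens ℝ), ℝ)) =
      seriesKernel α c ζ := by
  ext φ
  have hterm (s : ℕ) : regularDist (powerKernel (α * ((s + 1 : ℕ) : ℝ) + 1)) (-∂_{(1 : ℝ)} φ) =
      regularDist (powerKernel (α * (s + 1))) φ := by
    rw [← Distribution.lineDerivOp_apply_apply, Nat.cast_succ,
      lineDeriv_regularDist_powerKernel_add_one (by positivity)]
  have hzero : regularDist (powerKernel (α * ((0 : ℕ) : ℝ) + 1)) (-∂_{(1 : ℝ)} φ) = φ 0 := by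
    rw [← Distribution.lineDerivOp_apply_apply, Nat.cast_zero, mul_zero, zero_add,
      lineDeriv_regularDist_powerKernel_one]
  have hprim := hasSum_regularDist_kernelPrimitive hα ζ hc (-∂_{(1 : ℝ)} φ)
  have hdens := (hasSum_nat_add_iff' 1).2 hprim
  simp only [hterm, Finset.sum_range_one, pow_zero, one_mul, hzero] at hdens
  rw [Distribution.lineDerivOp_apply_apply, seriesKernel_apply,
    (hasSum_regularDist_kernelDensity hα ζ hc φ).unique hdens]
  ring

/-- The weights `s ↦ ∑ₘ aₘ (m)ₛ / s!` of the superposition `∑ₘ aₘ e^m` of Prabhakar kernels. -/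
noncomputable def superposedWeight (a : ℕ → ℝ) (s : ℕ) : ℝ := ∑' m : ℕ, a m * risingCoeff m s

lemma superposedWeight_zero (a : ℕ → ℝ) : superposedWeight a 0 = ∑' m, a m := by
  simp [superposedWeight, risingCoeff_zero_right]

lemma abs_mul_risingCoeff_natCast_le (a : ℕ → ℝ) (m s : ℕ) :
    |a m * risingCoeff m s| ≤ 2 ^ m * |a m| * 2 ^ s := by
  rw [abs_mul]
  calc _ ≤ |a m| * (2 ^ m * 2 ^ s) := by gcongr; exact abs_risingCoeff_natCast_le m s
    _ = _ := by ring

lemma hasSum_superposition {b : ℕ → ℕ → ℝ} {A w : ℕ → ℝ} (hb : ∀ m s, |b m s| ≤ A m * 2 ^ s)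
    (hA : Summable A) (hw : Summable fun s => 2 ^ s * |w s|) :
    HasSum (fun m => ∑' s, b m s * w s) (∑' s, (∑' m, b m s) * w s) := by
  have hsum : Summable (Function.uncurry fun m s => b m s * w s) := by
    refine Summable.of_norm_bounded
      (hA.mul_of_nonneg hw (fun m => nonneg_of_abs_le_two_pow (hb m)) fun s => by positivity) ?_
    rintro ⟨m, s⟩
    exact (abs_mul_le_of_two_pow (hb m) le_rfl)
  have hswap : ∑' s, (∑' m, b m s) * w s = ∑' m, ∑' s, b m s * w s := by
    rw [← hsum.tsum_comm]
    exact tsum_congr fun s => tsum_mul_right.symm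
  rw [hswap]
  exact hsum.prod.hasSum

section Superposition

variable {a : ℕ → ℝ} (ha : Summable fun m => 2 ^ m * |a m|)

include ha

lemma hasSum_superposedWeight (s : ℕ) :
    HasSum (fun m : ℕ => a m * risingCoeff m s) (superposedWeight a s) :=
  (Summable.of_norm_bounded (ha.mul_right _) fun m => abs_mul_risingCoeff_natCast_le a m s).hasSum

lemma abs_superposedWeight_le (s : ℕ) : |superposedWeight a s| ≤ (∑' m, 2 ^ m * |a m|) * 2 ^ s :=
  (hasSum_superposedWeight ha s).norm_le_of_bounded (ha.hasSum.mul_right (2 ^ s)) fun m =>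
    abs_mul_risingCoeff_natCast_le a m s

lemma hasSum_mul_tsum_risingCoeff {w : ℕ → ℝ} (hw : Summable fun s => 2 ^ s * |w s|) :
    HasSum (fun m : ℕ => a m * ∑' s, risingCoeff m s * w s) (∑' s, superposedWeight a s * w s) := by
  simpa only [mul_assoc, tsum_mul_left, superposedWeight] using
    hasSum_superposition (abs_mul_risingCoeff_natCast_le a) ha hw

lemma hasSum_mul_kernelDensity (hα : 0 < α) (ζ : ℝ) {x : ℝ} (hx : 0 < x) :
    HasSum (fun m : ℕ => a m * kernelDensity α (risingCoeff m) ζ x)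
      (kernelDensity α (superposedWeight a) ζ x) := by
  have hw : Summable fun s : ℕ => 2 ^ s * |ζ ^ (s + 1) * powerKernel (α * (s + 1)) x| :=
    (summable_geometric_two.mul_left (densityMajorant α ζ x)).of_nonneg_of_le
      (fun s => by positivity) fun s => le_trans (by gcongr <;> simp)
        (two_pow_mul_abs_powerKernel_le hα ζ hx s)
  simpa only [mul_assoc, tsum_mul_left, kernelDensity, superposedWeight] using hasSum_superposition
    (b := fun m s => a m * risingCoeff m (s + 1)) (A := fun m => 2 ^ m * |a m| * 2)
    (fun m s => (abs_mul_risingCoeff_natCast_le a m (s + 1)).trans_eq (by ring)) (ha.mul_right 2) hw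

lemma hasSum_mul_kernelPrimitive (hα : 0 < α) (ζ : ℝ) {x : ℝ} (hx : 0 ≤ x) :
    HasSum (fun m : ℕ => a m * kernelPrimitive α (risingCoeff m) ζ x)
      (kernelPrimitive α (superposedWeight a) ζ x) :=
  hasSum_mul_tsum_risingCoeff ha <| (summable_geometric_two.mul_left _).of_nonneg_of_le
    (fun s => by positivity) fun s => two_pow_mul_abs_powerKernel_add_one_le hα ζ hx s

theorem hasSum_mul_seriesKernel (hα : 0 < α) (ζ : ℝ) (φ : 𝓓((⊤ : Opens ℝ), ℝ)) :
    HasSum (fun m : ℕ => a m * seriesKernel α (risingCoeff m) ζ φ)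
      (seriesKernel α (superposedWeight a) ζ φ) := by
  have hdensity : HasSum (fun m : ℕ => a m * regularDist (kernelDensity α (risingCoeff m) ζ) φ)
      (regularDist (kernelDensity α (superposedWeight a) ζ) φ) := by
    have hcausal (m : ℕ) := isCausal_kernelDensity hα ζ (abs_risingCoeff_natCast_le m)
    refine (hasSum_regularDist (g := fun x => densityMajorant α ζ x * 2)
      (fun m => (hcausal m).const_mul (a m))
      (fun R => (integrableOn_densityMajorant hα ζ R).mul_const 2) ha (fun m x hx => ?_)
      (fun x hx => hasSum_mul_kernelDensity ha hα ζ hx)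
      (fun x hx => kernelDensity_of_neg α _ ζ hx) φ).congr_fun fun m =>
        ((hcausal m).regularDist_const_mul (a m) φ).symm
    rw [abs_mul]
    exact (mul_le_mul_of_nonneg_left
      (abs_kernelDensity_le hα ζ (abs_risingCoeff_natCast_le m) hx) (abs_nonneg _)).trans_eq
        (by ring)
  simp only [seriesKernel_apply, mul_add, risingCoeff_zero_right, one_mul]
  rw [superposedWeight_zero]
  refine .add (HasSum.mul_right _ (Summable.hasSum ?_)) hdensity
  simpa [risingCoeff_zero_right] using (hasSum_superposedWeight ha 0).summable

end Superposition

lemma prabhakarDensity_eq_kernelDensity (α γ ζ : ℝ) {x : ℝ} (hx : 0 < x) :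
    prabhakarDensity α γ ζ x = kernelDensity α (risingCoeff γ) ζ x := by
  rw [prabhakarDensity, if_pos hx, kernelDensity]
  simp only [powerKernel_of_nonneg _ hx.le, risingCoeff, mul_div_assoc]

lemma heaviside_mul_prabhakar_eq_kernelPrimitive (α γ ζ x : ℝ) :
    heaviside x * prabhakar α 1 γ (ζ * x ^ α) = kernelPrimitive α (risingCoeff γ) ζ x := by
  rcases lt_or_ge x 0 with hx | hx
  · rw [heaviside, if_neg hx.not_ge, zero_mul, kernelPrimitive_of_neg _ _ _ hx]
  · rw [heaviside, if_pos hx, one_mul, prabhakar, kernelPrimitive]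
    simp only [powerKernel_add_one_of_nonneg _ hx, risingCoeff, mul_pow, Real.rpow_mul_natCast hx,
      mul_div_assoc]

lemma prabhakarKernel_eq_seriesKernel (hα : 0 < α) {γ : ℝ} (ζ : ℝ)
    (hγ : ∀ s, |risingCoeff γ s| ≤ C * 2 ^ s) :
    prabhakarKernel α γ ζ = seriesKernel α (risingCoeff γ) ζ := by
  rw [prabhakarKernel, seriesKernel, risingCoeff_zero_right, one_smul,
    (isCausal_kernelDensity hα ζ hγ).regularDist_congr fun x hx => ?_]
  rcases hx.lt_or_gt with hneg | hpos
  · rw [kernelDensity_of_neg _ _ _ hneg, prabhakarDensity, if_neg hneg.not_gt]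
  · exact (prabhakarDensity_eq_kernelDensity α γ ζ hpos).symm

end SeriesKernel

section LatticeDensity

variable {h : ℝ} {q : ℕ → ℝ}

lemma latticeDensity_of_mem_Ioo {x : ℝ} (hx : x ∈ Ioo 0 h) :
    latticeDensity h q x = 1 / h * q 0 := by
  have hh : 0 < h := hx.1.trans hx.2
  rw [latticeDensity, if_pos hx.1.le, Nat.floor_eq_zero.2 ((div_lt_one hh).2 hx.2)]

lemma isCausal_latticeDensity (hh : 0 < h) (q : ℕ → ℝ) : IsCausal (latticeDensity h q) where
  eq_zero_of_neg x hx := if_neg hx.not_ge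
  integrableOn R := by
    have hmeas : Measurable (latticeDensity h q) := by
      refine Measurable.ite measurableSet_Ici (Measurable.const_mul ?_ _) measurable_const
      exact (measurable_from_nat (f := q)).comp
        (Nat.measurable_floor.comp (measurable_id.div_const h))
    refine Integrable.mono'
      (integrable_const (1 / h * ∑ n ∈ Finset.range (⌊R / h⌋₊ + 1), |q n|))
      hmeas.aestronglyMeasurable ?_
    filter_upwards [ae_restrict_mem measurableSet_Ioc] with x hx
    have hfloor : ⌊x / h⌋₊ ∈ Finset.range (⌊R / h⌋₊ + 1) :=
      Finset.mem_range_succ_iff.2 (Nat.floor_mono (by have := hx.2; gcongr))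
    rw [latticeDensity, if_pos hx.1.le, norm_mul, Real.norm_of_nonneg (by positivity)]
    exact mul_le_mul_of_nonneg_left
      (Finset.single_le_sum (f := fun n => |q n|) (fun n _ => abs_nonneg _) hfloor) (by positivity)

/- The first cell `(0, h)` carries the mass `q 0`, which turns into the Dirac mass in the limit. -/
lemma regularDist_latticeDensity (hh : 0 < h) (q : ℕ → ℝ) {φ : 𝓓((⊤ : Opens ℝ), ℝ)} {R : ℝ}
    (hR : ∀ x, R < x → φ x = 0) (hhR : h ≤ R) :
    regularDist (latticeDensity h q) φ = q 0 * (1 / h * ∫ x in Ioc 0 h, φ x) +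
      ∫ x in Ioc 0 R, (Ioi h).indicator (fun x => φ x * latticeDensity h q x) x := by
  obtain ⟨M, -, hM⟩ := exists_forall_abs_le φ
  have hcausal := isCausal_latticeDensity hh q
  have hinteg : IntegrableOn (fun x => φ x * latticeDensity h q x) (Ioc 0 R) :=
    (hcausal.integrableOn R).bdd_mul φ.continuous.aestronglyMeasurable (ae_of_all _ hM)
  have hcell :
      ∫ x in Ioc 0 h, φ x * latticeDensity h q x = q 0 * (1 / h * ∫ x in Ioc 0 h, φ x) := by
    rw [← mul_assoc, ← integral_const_mul, integral_Ioc_eq_integral_Ioo,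
      integral_Ioc_eq_integral_Ioo]
    refine setIntegral_congr_fun measurableSet_Ioo fun x hx => ?_
    rw [latticeDensity_of_mem_Ioo hx]
    ring
  rw [hcausal.regularDist_apply hR, ← Ioc_union_Ioc_eq_Ioc hh.le hhR,
    setIntegral_union (Ioc_disjoint_Ioc_of_le le_rfl) measurableSet_Ioc
      (hinteg.mono_set (Ioc_subset_Ioc_right hhR)) (hinteg.mono_set (Ioc_subset_Ioc_left hh.le)),
    Ioc_union_Ioc_eq_Ioc hh.le hhR, setIntegral_indicator measurableSet_Ioi, Ioc_inter_Ioi,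
    sup_eq_right.2 hh.le, hcell]

end LatticeDensity

lemma tendsto_average_Ioc {f : ℝ → ℝ} (hf : Continuous f) :
    Tendsto (fun h : ℝ => 1 / h * ∫ x in Ioc 0 h, f x) (𝓝[>] 0) (𝓝 (f 0)) := by
  have hderiv := intervalIntegral.integral_hasDerivAt_right (a := 0) (b := 0)
    (hf.intervalIntegrable _ _) (hf.stronglyMeasurableAtFilter _ _) hf.continuousAt
  refine ((hasDerivAt_iff_tendsto_slope.1 hderiv).mono_left
    (nhdsWithin_mono 0 fun y (hy : 0 < y) => hy.ne')).congr' ?_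
  filter_upwards [self_mem_nhdsWithin] with y (hy : 0 < y)
  simp [slope, intervalIntegral.integral_of_le hy.le]

lemma tendsto_rpow_nhdsGT_zero {α : ℝ} (hα : 0 < α) :
    Tendsto (fun h : ℝ => h ^ α) (𝓝[>] 0) (𝓝 0) := by
  simpa only [Real.zero_rpow hα.ne'] using
    ((Real.continuous_rpow_const hα.le).tendsto 0).mono_left nhdsWithin_le_nhds

lemma eventually_nhdsGT_zero_lt {x : ℝ} (hx : 0 < x) : ∀ᶠ h in 𝓝[>] (0 : ℝ), h < x :=
  (gt_mem_nhds hx).filter_mono nhdsWithin_le_nhds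

/-- The sequences `q h` on the lattices `h ℕ` are, for small `h`, superpositions of the coefficients
of `(ζ h ^ α (1 - u) ^ (-α)) ^ s`, `s ∈ ℕ`, with weights `c h` that are uniformly bounded by
`C 2 ^ s` and converge to `c₀`. -/
structure IsLatticeApprox (α ζ C : ℝ) (c₀ : ℕ → ℝ) (c : ℝ → ℕ → ℝ) (q : ℝ → ℕ → ℝ) : Prop where
  tendsto : ∀ s, Tendsto (fun h => c h s) (𝓝[>] 0) (𝓝 (c₀ s))
  abs_le : ∀ᶠ h in 𝓝[>] 0, ∀ s, |c h s| ≤ C * 2 ^ s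
  hasSum : ∀ᶠ h in 𝓝[>] 0, ∀ n,
    HasSum (fun s : ℕ => c h s * ((ζ * h ^ α) ^ s * risingCoeff (α * s) n)) (q h n)

namespace IsLatticeApprox

variable {α ζ C x : ℝ} {c₀ : ℕ → ℝ} {c : ℝ → ℕ → ℝ} {q : ℝ → ℕ → ℝ}

lemma abs_limit_le (H : IsLatticeApprox α ζ C c₀ c q) (s : ℕ) : |c₀ s| ≤ C * 2 ^ s :=
  le_of_tendsto (H.tendsto s).abs (H.abs_le.mono fun _ hc => hc s)

lemma hasSum_latticeDensity (H : IsLatticeApprox α ζ C c₀ c q) :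
    ∀ᶠ h in 𝓝[>] (0 : ℝ), ∀ x, h ≤ x →
      HasSum (fun s : ℕ => c h (s + 1) * (ζ ^ (s + 1) * latticePowerKernel (α * (s + 1)) h x))
        (latticeDensity h (q h) x) := by
  filter_upwards [H.hasSum, self_mem_nhdsWithin] with h hq (hh : 0 < h) x hx
  have hfloor : ⌊x / h⌋₊ ≠ 0 := (Nat.floor_pos.2 ((one_le_div hh).2 hx)).ne'
  have hpow (s : ℕ) : (ζ * h ^ α) ^ (s + 1) = ζ ^ (s + 1) * (h ^ (α * (s + 1) - 1) * h) := by
    rw [← Real.rpow_add_one hh.ne', sub_add_cancel, mul_pow, ← Real.rpow_mul_natCast hh.le,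
      Nat.cast_succ]
  have htail := ((hasSum_nat_add_iff' 1).2 (hq ⌊x / h⌋₊)).mul_left (1 / h)
  rw [Finset.sum_range_one, Nat.cast_zero, mul_zero, risingCoeff_zero_left hfloor, mul_zero,
    mul_zero, sub_zero] at htail
  rw [latticeDensity, if_pos (hh.le.trans hx)]
  refine htail.congr_fun fun s => ?_
  rw [hpow, latticePowerKernel, Nat.cast_succ]
  field_simp

lemma abs_term_le (hα : 0 < α) (H : IsLatticeApprox α ζ C c₀ c q) :
    ∀ᶠ h in 𝓝[>] (0 : ℝ), ∀ x, h ≤ x → ∀ s : ℕ,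
      |c h (s + 1) * (ζ ^ (s + 1) * latticePowerKernel (α * (s + 1)) h x)| ≤
        C * (densityMajorant α ζ x * (1 / 2) ^ s) := by
  have hrate : 0 < 4 * growthRate α ζ := by linarith [growthRate_pos α ζ]
  filter_upwards [H.abs_le, eventually_nhdsGT_zero_lt (inv_pos.2 hrate), self_mem_nhdsWithin]
    with h hc hsmall (hh : 0 < h) x hx s
  refine abs_mul_le_of_two_pow hc (two_pow_mul_abs_latticePowerKernel_le hα ζ hh hx ?_ s)
  exact (mul_le_mul_of_nonneg_left hsmall.le hrate.le).trans_eq (mul_inv_cancel₀ hrate.ne')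

lemma tendsto_latticeDensity (hα : 0 < α) (H : IsLatticeApprox α ζ C c₀ c q) (hx : 0 < x) :
    Tendsto (fun h => latticeDensity h (q h) x) (𝓝[>] 0) (𝓝 (kernelDensity α c₀ ζ x)) := by
  have hlim := tendsto_tsum_of_dominated_convergence (𝓕 := 𝓝[>] (0 : ℝ))
    (f := fun h (s : ℕ) => c h (s + 1) * (ζ ^ (s + 1) * latticePowerKernel (α * (s + 1)) h x))
    (g := fun s : ℕ => c₀ (s + 1) * (ζ ^ (s + 1) * powerKernel (α * (s + 1)) x))
    ((summable_geometric_two.mul_left (densityMajorant α ζ x)).mul_left C)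
    (fun s => (H.tendsto (s + 1)).mul
      ((tendsto_latticePowerKernel (by positivity) hx).const_mul _)) ?_
  · refine hlim.congr' ?_
    filter_upwards [H.hasSum_latticeDensity, eventually_nhdsGT_zero_lt hx] with h hsum hhx
    exact (hsum x hhx.le).tsum_eq
  · filter_upwards [H.abs_term_le hα, eventually_nhdsGT_zero_lt hx] with h hterm hhx
    exact hterm x hhx.le

lemma abs_latticeDensity_le (hα : 0 < α) (H : IsLatticeApprox α ζ C c₀ c q) :
    ∀ᶠ h in 𝓝[>] (0 : ℝ), ∀ x, h ≤ x →
      |latticeDensity h (q h) x| ≤ C * (densityMajorant α ζ x * 2) := by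
  filter_upwards [H.hasSum_latticeDensity, H.abs_term_le hα] with h hsum hterm x hx
  exact (hsum x hx).norm_le_of_bounded ((hasSum_geometric_two.mul_left _).mul_left C) (hterm x hx)

lemma tendsto_apply_zero (hα : 0 < α) (H : IsLatticeApprox α ζ C c₀ c q) :
    Tendsto (fun h => q h 0) (𝓝[>] 0) (𝓝 (c₀ 0)) := by
  have hbase : Tendsto (fun h : ℝ => ζ * h ^ α) (𝓝[>] 0) (𝓝 0) := by
    simpa using (tendsto_rpow_nhdsGT_zero hα).const_mul ζ
  have hsmall : ∀ᶠ h in 𝓝[>] (0 : ℝ), |ζ * h ^ α| < 1 / 4 := by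
    refine hbase.abs.eventually_lt_const ?_
    norm_num
  have hlim := tendsto_tsum_of_dominated_convergence (𝓕 := 𝓝[>] (0 : ℝ))
    (f := fun h (s : ℕ) => c h s * (ζ * h ^ α) ^ s) (g := fun s => c₀ s * 0 ^ s)
    (summable_geometric_two.mul_left C) (fun s => (H.tendsto s).mul (hbase.pow s)) ?_
  · rw [tsum_eq_single 0 fun s hs => by simp [hs], pow_zero, mul_one] at hlim
    refine hlim.congr' ?_
    filter_upwards [H.hasSum] with h hq
    simpa [risingCoeff_zero_right] using (hq 0).tsum_eq
  · filter_upwards [H.abs_le, hsmall] with h hc hh s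
    refine abs_mul_le_of_two_pow hc ?_
    rw [abs_pow, ← mul_pow]
    exact pow_le_pow_left₀ (by positivity) (by linarith) s

lemma tendsto_integral_indicator_Ioi (hα : 0 < α) (H : IsLatticeApprox α ζ C c₀ c q)
    (φ : 𝓓((⊤ : Opens ℝ), ℝ)) (R : ℝ) :
    Tendsto (fun h => ∫ x in Ioc 0 R,
        (Ioi h).indicator (fun x => φ x * latticeDensity h (q h) x) x) (𝓝[>] 0)
      (𝓝 (∫ x in Ioc 0 R, φ x * kernelDensity α c₀ ζ x)) := by
  obtain ⟨M, hM0, hM⟩ := exists_forall_abs_le φ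
  have hC := nonneg_of_abs_le_two_pow H.abs_limit_le
  refine tendsto_integral_filter_of_dominated_convergence
    (fun x => M * (C * (densityMajorant α ζ x * 2))) ?_ ?_ ?_ ?_
  · filter_upwards [self_mem_nhdsWithin] with h (hh : 0 < h)
    exact (φ.continuous.aestronglyMeasurable.mul
      ((isCausal_latticeDensity hh (q h)).integrableOn R).aestronglyMeasurable).indicator
        measurableSet_Ioi
  · filter_upwards [H.abs_latticeDensity_le hα] with h hle
    filter_upwards [ae_restrict_mem measurableSet_Ioc] with x hx
    by_cases hxh : x ∈ Ioi h
    · rw [indicator_of_mem hxh, norm_mul]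
      exact mul_le_mul (hM x) (hle x (le_of_lt hxh)) (norm_nonneg _) hM0
    · rw [indicator_of_notMem hxh, norm_zero]
      have := densityMajorant_nonneg hα.le ζ hx.1.le
      positivity
  · exact (((integrableOn_densityMajorant hα ζ R).mul_const 2).const_mul C).const_mul M
  · filter_upwards [ae_restrict_mem measurableSet_Ioc] with x hx
    refine ((H.tendsto_latticeDensity hα hx.1).const_mul (φ x)).congr' ?_
    filter_upwards [eventually_nhdsGT_zero_lt hx.1] with h hh
    rw [indicator_of_mem (by exact hh)]

theorem tendsto_regularDist (hα : 0 < α) (H : IsLatticeApprox α ζ C c₀ c q)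
    (φ : 𝓓((⊤ : Opens ℝ), ℝ)) :
    Tendsto (fun h => regularDist (latticeDensity h (q h)) φ) (𝓝[>] 0)
      (𝓝 (seriesKernel α c₀ ζ φ)) := by
  obtain ⟨R, hR0, hR⟩ := exists_pos_forall_lt_eq_zero φ
  rw [seriesKernel_apply, (isCausal_kernelDensity hα ζ H.abs_limit_le).regularDist_apply hR]
  refine (((H.tendsto_apply_zero hα).mul (tendsto_average_Ioc φ.continuous)).add
    (H.tendsto_integral_indicator_Ioi hα φ R)).congr' ?_
  filter_upwards [self_mem_nhdsWithin, eventually_nhdsGT_zero_lt hR0] with h (hh : 0 < h) hhR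
  exact (regularDist_latticeDensity hh (q h) hR hhR.le).symm

end IsLatticeApprox

section GeneratingFunction

variable {f g : ℝ → ℝ} {a : ℕ → ℝ}

lemma hasFPowerSeriesAt_ofScalars_of_hasSum (h : ∀ᶠ u in 𝓝 0, HasSum (fun n => a n * u ^ n) (f u)) :
    HasFPowerSeriesAt f (FormalMultilinearSeries.ofScalars ℝ a) 0 := by
  rw [hasFPowerSeriesAt_iff]
  filter_upwards [h] with u hu
  simpa [FormalMultilinearSeries.coeff_ofScalars, mul_comm] using hu

lemma gfCoeff_eq_of_hasSum (h : ∀ᶠ u in 𝓝 0, HasSum (fun n => a n * u ^ n) (f u)) (n : ℕ) :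
    gfCoeff f n = a n := by
  have hseries := hasFPowerSeriesAt_ofScalars_of_hasSum h
  have heq := HasFPowerSeriesAt.eq_formalMultilinearSeries
    hseries.analyticAt.hasFPowerSeriesAt hseries
  have hcoeff := congrArg (fun p => FormalMultilinearSeries.coeff p n) heq
  simpa [FormalMultilinearSeries.coeff_ofScalars, gfCoeff] using hcoeff

lemma gfCoeff_congr (h : f =ᶠ[𝓝 0] g) (n : ℕ) : gfCoeff f n = gfCoeff g n := by
  rw [gfCoeff, gfCoeff, h.iteratedDeriv_eq]

lemma gfCoeff_mul (hf : AnalyticAt ℝ f 0) (hg : AnalyticAt ℝ g 0) (n : ℕ) :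
    gfCoeff (f * g) n = ∑ k ∈ Finset.range (n + 1), gfCoeff f k * gfCoeff g (n - k) := by
  rw [gfCoeff, iteratedDeriv_mul hf.contDiffAt hg.contDiffAt, Finset.sum_div]
  refine Finset.sum_congr rfl fun k hk => ?_
  rw [gfCoeff, gfCoeff, Nat.cast_choose ℝ (Finset.mem_range_succ_iff.1 hk)]
  have := n.factorial_pos
  have := k.factorial_pos
  have := (n - k).factorial_pos
  field_simp

end GeneratingFunction

lemma eventually_abs_lt_half : ∀ᶠ u : ℝ in 𝓝 0, |u| < 1 / 2 :=
  continuous_abs.continuousAt.eventually_lt_const (by norm_num)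

section DiscretePrabhakar

variable {α ζ lam u : ℝ}

lemma two_pow_mul_abs_pow_mul_risingCoeff_le (hα : 0 ≤ α) (hζ : |ζ| * 2 ^ α ≤ 1 / 4) (s n : ℕ) :
    2 ^ s * |ζ ^ s * risingCoeff (α * s) n| ≤ 2 ^ n * (1 / 2) ^ s := by
  have ha : 0 ≤ α * s := by positivity
  have hcoeff : risingCoeff (α * s) n ≤ 2 ^ n * (2 ^ α) ^ s := by
    refine (risingCoeff_le ha (r := 1 / 2) (by norm_num) (by norm_num) n).trans_eq ?_
    rw [show (1 : ℝ) - 1 / 2 = 2⁻¹ by norm_num, Real.inv_rpow zero_le_two,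
      Real.rpow_neg zero_le_two, inv_inv, Real.rpow_mul_natCast zero_le_two, one_div, inv_pow,
      inv_inv]
  rw [abs_mul, abs_pow, abs_of_nonneg (risingCoeff_nonneg ha n)]
  calc (2 : ℝ) ^ s * (|ζ| ^ s * risingCoeff (α * s) n)
      ≤ 2 ^ s * (|ζ| ^ s * (2 ^ n * (2 ^ α) ^ s)) := by gcongr
    _ = 2 ^ n * (2 * (|ζ| * 2 ^ α)) ^ s := by simp only [mul_pow]; ring
    _ ≤ 2 ^ n * (1 / 2) ^ s := by gcongr; linarith

lemma abs_mul_one_sub_rpow_neg_lt (hα : 0 ≤ α) (hζ : |ζ| * 2 ^ α ≤ 1 / 4) (hu : |u| < 1 / 2) :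
    |ζ * (1 - u) ^ (-α)| < 1 := by
  have hbase : 1 / 2 ≤ 1 - u := by linarith [le_abs_self u]
  have hpow : (1 - u) ^ (-α) ≤ 2 ^ α := by
    rw [← inv_inv (2 : ℝ), Real.inv_rpow (by norm_num), ← Real.rpow_neg (by norm_num)]
    exact Real.rpow_le_rpow_of_nonpos (by norm_num) (by linarith) (by linarith)
  rw [abs_mul, abs_of_nonneg (Real.rpow_nonneg (by linarith) _)]
  linarith [mul_le_mul_of_nonneg_left hpow (abs_nonneg ζ)]

lemma hasSum_tsum_mul_pow {C : ℝ} {c : ℕ → ℝ} (hα : 0 ≤ α) (hζ : |ζ| * 2 ^ α ≤ 1 / 4)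
    (hc : ∀ s, |c s| ≤ C * 2 ^ s) (hu : |u| < 1 / 2) :
    HasSum (fun n => (∑' s : ℕ, c s * (ζ ^ s * risingCoeff (α * s) n)) * u ^ n)
      (∑' s : ℕ, c s * (ζ * (1 - u) ^ (-α)) ^ s) := by
  set F : ℕ → ℕ → ℝ := fun n s => c s * (ζ ^ s * risingCoeff (α * s) n) * u ^ n
  have hF : Summable (Function.uncurry F) := by
    have hgeom : Summable fun n : ℕ => C * (2 * |u|) ^ n :=
      (summable_geometric_of_lt_one (by positivity) (by linarith)).mul_left C
    have hC := nonneg_of_abs_le_two_pow hc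
    refine Summable.of_norm_bounded
      (hgeom.mul_of_nonneg summable_geometric_two (fun n => by positivity)
        fun s => by positivity) ?_
    rintro ⟨n, s⟩
    have hterm := abs_mul_le_of_two_pow hc (two_pow_mul_abs_pow_mul_risingCoeff_le hα hζ s n)
    calc |F n s| = |c s * (ζ ^ s * risingCoeff (α * s) n)| * |u| ^ n := by
          rw [abs_mul _ (u ^ n), abs_pow]
      _ ≤ C * (2 ^ n * (1 / 2) ^ s) * |u| ^ n := by gcongr
      _ = C * (2 * |u|) ^ n * (1 / 2) ^ s := by rw [mul_pow]; ring
  have hrow (s : ℕ) : ∑' n, F n s = c s * (ζ * (1 - u) ^ (-α)) ^ s := by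
    have hbinomial := (hasSum_risingCoeff (α * s) (hu.trans one_half_lt_one)).tsum_eq
    rw [← neg_mul, Real.rpow_mul_natCast (by linarith [le_abs_self u])] at hbinomial
    rw [mul_pow, ← hbinomial, ← tsum_mul_left, ← tsum_mul_left]
    exact tsum_congr fun n => by ring
  have htotal : HasSum (fun n => ∑' s, F n s) (∑' n, ∑' s, F n s) := hF.prod.hasSum
  rw [← hF.tsum_comm] at htotal
  simpa only [hrow, F, tsum_mul_right] using htotal

lemma hasSum_generatingFunction (hα : 0 ≤ α) (hlam : |lam| * 2 ^ α ≤ 1 / 4) (m : ℕ)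
    (hu : |u| < 1 / 2) :
    HasSum (fun n => (∑' s : ℕ, risingCoeff m s * ((-lam) ^ s * risingCoeff (α * s) n)) * u ^ n)
      (((1 + lam * (1 - u) ^ (-α)) ^ m)⁻¹) := by
  rw [← abs_neg] at hlam
  have hlt := abs_mul_one_sub_rpow_neg_lt hα hlam hu
  have hbase : 0 ≤ 1 - -lam * (1 - u) ^ (-α) := by linarith [(abs_lt.1 hlt).2]
  rw [← Real.rpow_natCast, ← sub_neg_eq_add, ← neg_mul, ← Real.rpow_neg hbase,
    ← (hasSum_risingCoeff m hlt).tsum_eq]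
  exact hasSum_tsum_mul_pow hα hlam (abs_risingCoeff_natCast_le m) hu

lemma discretePrabhakar_eq_tsum (hα : 0 ≤ α) (hlam : |lam| * 2 ^ α ≤ 1 / 4) (m n : ℕ) :
    discretePrabhakar α m lam n =
      ∑' s : ℕ, risingCoeff m s * ((-lam) ^ s * risingCoeff (α * s) n) :=
  gfCoeff_eq_of_hasSum
    (eventually_abs_lt_half.mono fun _ hu => hasSum_generatingFunction hα hlam m hu) n

lemma summable_two_pow_mul_abs_pow_mul_risingCoeff (hα : 0 ≤ α) (hζ : |ζ| * 2 ^ α ≤ 1 / 4)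
    (n : ℕ) : Summable fun s : ℕ => 2 ^ s * |ζ ^ s * risingCoeff (α * s) n| :=
  (summable_geometric_two.mul_left _).of_nonneg_of_le (fun s => by positivity)
    fun s => two_pow_mul_abs_pow_mul_risingCoeff_le hα hζ s n

lemma summable_mul_pow_mul_risingCoeff {C : ℝ} {c : ℕ → ℝ} (hα : 0 ≤ α)
    (hζ : |ζ| * 2 ^ α ≤ 1 / 4) (hc : ∀ s, |c s| ≤ C * 2 ^ s) (n : ℕ) :
    Summable fun s : ℕ => c s * (ζ ^ s * risingCoeff (α * s) n) :=
  ((summable_two_pow_mul_abs_pow_mul_risingCoeff hα hζ n).mul_left C).of_norm_bounded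
    fun _ => abs_mul_le_of_two_pow hc le_rfl

lemma gML_eventuallyEq (α lam : ℝ) :
    gML α lam =ᶠ[𝓝 0] fun u => ((1 + lam * (1 - u) ^ (-α)) ^ 1)⁻¹ := by
  filter_upwards [eventually_abs_lt_half] with u hu
  have hbase : 0 < 1 - u := by linarith [le_abs_self u]
  rw [gML, pow_one, Real.rpow_neg hbase.le]
  field_simp
  rw [add_comm]

lemma discretePrabhakar_zero (α lam : ℝ) (n : ℕ) :
    discretePrabhakar α 0 lam n = if n = 0 then 1 else 0 := by
  refine gfCoeff_eq_of_hasSum (a := fun n => if n = 0 then 1 else 0)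
    (Eventually.of_forall fun u => ?_) n
  convert hasSum_ite_eq (0 : ℕ) (1 : ℝ) using 2 with n
  · split_ifs with h <;> simp [h]
  · simp

lemma discretePrabhakar_succ (hα : 0 ≤ α) (hlam : |lam| * 2 ^ α ≤ 1 / 4) (m n : ℕ) :
    discretePrabhakar α (m + 1) lam n = ∑ k ∈ Finset.range (n + 1),
      discretePrabhakar α m lam k * gfCoeff (gML α lam) (n - k) := by
  have hanalytic (m : ℕ) : AnalyticAt ℝ (fun u : ℝ => ((1 + lam * (1 - u) ^ (-α)) ^ m)⁻¹) 0 :=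
    (hasFPowerSeriesAt_ofScalars_of_hasSum (eventually_abs_lt_half.mono fun _ hu =>
      hasSum_generatingFunction hα hlam m hu)).analyticAt
  simp only [gfCoeff_congr (gML_eventuallyEq α lam), discretePrabhakar,
    ← gfCoeff_mul (hanalytic m) (hanalytic 1)]
  congr 1
  ext u
  simp only [Pi.mul_apply, pow_succ, pow_zero, one_mul, mul_inv]

end DiscretePrabhakar

section Laplace

variable {a : ℝ} {s : ℂ}

lemma integral_exp_neg_mul_powerKernel {σ : ℝ} (ha : 0 < a) (hσ : 0 < σ) :
    ∫ x in Ioi (0 : ℝ), Real.exp (-σ * x) * powerKernel a x = σ ^ (-a) := by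
  have hG := (Real.Gamma_pos_of_pos ha).ne'
  calc ∫ x in Ioi (0 : ℝ), Real.exp (-σ * x) * powerKernel a x
      = ∫ x in Ioi (0 : ℝ), x ^ (a - 1) * Real.exp (-(σ * x)) / Real.Gamma a := by
        refine setIntegral_congr_fun measurableSet_Ioi fun x (hx : 0 < x) => ?_
        rw [powerKernel_of_nonneg a hx.le, neg_mul]
        ring
    _ = σ ^ (-a) := by
        rw [integral_div, Real.integral_rpow_mul_exp_neg_mul_Ioi ha hσ, mul_div_cancel_right₀ _ hG,
          one_div, Real.inv_rpow hσ.le, Real.rpow_neg hσ.le]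

lemma norm_exp_mul_powerKernel (ha : 0 < a) (s : ℂ) (x : ℝ) :
    ‖Complex.exp (-s * x) * (powerKernel a x : ℂ)‖ = Real.exp (-s.re * x) * powerKernel a x := by
  rw [norm_mul, Complex.norm_exp, Complex.norm_real, Real.norm_of_nonneg (powerKernel_nonneg ha x),
    Complex.re_mul_ofReal, Complex.neg_re]

lemma integral_norm_exp_mul_powerKernel (ha : 0 < a) (hs : 0 < s.re) :
    ∫ x in Ioi (0 : ℝ), ‖Complex.exp (-s * x) * (powerKernel a x : ℂ)‖ = s.re ^ (-a) := by
  simp only [norm_exp_mul_powerKernel ha, integral_exp_neg_mul_powerKernel ha hs]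

lemma integrableOn_exp_mul_powerKernel (ha : 0 < a) (hs : 0 < s.re) :
    IntegrableOn (fun x : ℝ => Complex.exp (-s * x) * (powerKernel a x : ℂ)) (Ioi 0) := by
  have hmeas : Measurable fun x : ℝ => Complex.exp (-s * x) * (powerKernel a x : ℂ) :=
    (by fun_prop : Measurable fun x : ℝ => Complex.exp (-s * x)).mul
      (measurable_powerKernel a).complex_ofReal
  refine (integrable_norm_iff hmeas.aestronglyMeasurable).1 (.of_integral_ne_zero ?_)
  rw [integral_norm_exp_mul_powerKernel ha hs]
  exact (Real.rpow_pos_of_pos hs _).ne'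

/-- The measure `x ^ (a - 1) / Γ(a) dx` on `(0, ∞)`. Its moment generating function is the Laplace
transform of `powerKernel a`, up to the sign of the variable. -/
noncomputable def powerKernelMeasure (a : ℝ) : Measure ℝ :=
  (volume.restrict (Ioi 0)).withDensity fun x => ENNReal.ofReal (powerKernel a x)

lemma integral_powerKernelMeasure (ha : 0 < a) (f : ℝ → ℂ) :
    ∫ x, f x ∂(powerKernelMeasure a) = ∫ x in Ioi 0, f x * (powerKernel a x : ℂ) := by
  rw [powerKernelMeasure, integral_withDensity_eq_integral_toReal_smul
    (measurable_powerKernel a).ennreal_ofReal (.of_forall fun _ => ENNReal.ofReal_lt_top)]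
  simp only [ENNReal.toReal_ofReal (powerKernel_nonneg ha _), Complex.real_smul, mul_comm]

lemma integrable_powerKernelMeasure_iff (ha : 0 < a) (f : ℝ → ℂ) :
    Integrable f (powerKernelMeasure a) ↔
      IntegrableOn (fun x => f x * (powerKernel a x : ℂ)) (Ioi 0) := by
  rw [powerKernelMeasure, integrable_withDensity_iff_integrable_smul'
    (measurable_powerKernel a).ennreal_ofReal (.of_forall fun _ => ENNReal.ofReal_lt_top)]
  simp only [ENNReal.toReal_ofReal (powerKernel_nonneg ha _), Complex.real_smul, mul_comm]
  rfl

lemma complexMGF_powerKernelMeasure (ha : 0 < a) (s : ℂ) :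
    ProbabilityTheory.complexMGF id (powerKernelMeasure a) (-s) =
      ∫ x in Ioi (0 : ℝ), Complex.exp (-s * x) * (powerKernel a x : ℂ) :=
  integral_powerKernelMeasure ha _

lemma Iio_subset_integrableExpSet (ha : 0 < a) :
    Iio 0 ⊆ ProbabilityTheory.integrableExpSet id (powerKernelMeasure a) := by
  intro t (ht : t < 0)
  have hexp := ((integrable_powerKernelMeasure_iff ha fun x => Complex.exp (-(-t : ℂ) * x)).2
    (integrableOn_exp_mul_powerKernel ha (by simpa using ht))).norm
  simpa [ProbabilityTheory.integrableExpSet, Complex.norm_exp] using hexp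

lemma complexMGF_powerKernelMeasure_ofReal {t : ℝ} (ha : 0 < a) (ht : t < 0) :
    ProbabilityTheory.complexMGF id (powerKernelMeasure a) t = (-t : ℂ) ^ (-a : ℂ) := by
  have ht' : 0 < -t := neg_pos.2 ht
  rw [← neg_neg (t : ℂ), complexMGF_powerKernelMeasure ha, neg_neg, ← Complex.ofReal_neg,
    ← Complex.ofReal_neg, ← Complex.ofReal_cpow ht'.le, ← integral_exp_neg_mul_powerKernel ha ht',
    ← integral_complex_ofReal]
  push_cast
  simp only [neg_neg]

/- Both sides are analytic in the half-plane, and agree for real `s`. -/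
lemma integral_exp_mul_powerKernel (ha : 0 < a) (hs : 0 < s.re) :
    ∫ x in Ioi (0 : ℝ), Complex.exp (-s * x) * (powerKernel a x : ℂ) = s ^ (-a : ℂ) := by
  set U : Set ℂ := {z | z.re < 0}
  have hmgf : AnalyticOnNhd ℂ (ProbabilityTheory.complexMGF id (powerKernelMeasure a)) U :=
    fun z hz => ProbabilityTheory.analyticAt_complexMGF
      (interior_maximal (Iio_subset_integrableExpSet ha) isOpen_Iio hz)
  have hpow : AnalyticOnNhd ℂ (fun z : ℂ => (-z) ^ (-a : ℂ)) U := fun z hz =>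
    analyticAt_id.neg.cpow analyticAt_const (Or.inl (by simpa [U] using hz))
  have hconn : IsPreconnected U :=
    ((convex_Iio (0 : ℝ)).linear_preimage Complex.reLm).isPreconnected
  have hofReal : Tendsto ((↑) : ℝ → ℂ) (𝓝[≠] (-1)) (𝓝[≠] ((-1 : ℝ) : ℂ)) :=
    Complex.continuous_ofReal.continuousWithinAt.tendsto_nhdsWithin
      fun _ => Complex.ofReal_injective.ne
  have hreal : ∀ᶠ t : ℝ in 𝓝[≠] (-1), t < 0 := nhdsWithin_le_nhds (gt_mem_nhds neg_one_lt_zero)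
  have heq := hmgf.eqOn_of_preconnected_of_frequently_eq hpow hconn
    (by simp [U] : ((-1 : ℝ) : ℂ) ∈ U)
    (hofReal.frequently (hreal.mono fun _ => complexMGF_powerKernelMeasure_ofReal ha).frequently)
  rw [← complexMGF_powerKernelMeasure ha, heq (by simpa [U] using hs : -s ∈ U)]
  simp only [neg_neg]

lemma integrable_of_hasSum_of_summable_integral_norm {X E : Type*} [MeasurableSpace X]
    {μ : Measure X} [NormedAddCommGroup E] {F : ℕ → X → E} {f : X → E}
    (hF : ∀ i, Integrable (F i) μ) (hsum : Summable fun i => ∫ x, ‖F i x‖ ∂μ)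
    (hf : ∀ᵐ x ∂μ, HasSum (fun i => F i x) (f x)) : Integrable f μ := by
  refine ⟨aestronglyMeasurable_of_tendsto_ae atTop (f := fun N x => ∑ i ∈ Finset.range N, F i x)
    (fun N => Finset.aestronglyMeasurable_fun_sum _ fun i _ => (hF i).1)
    (hf.mono fun x hx => hx.tendsto_sum_nat), ?_⟩
  calc ∫⁻ x, ‖f x‖ₑ ∂μ ≤ ∫⁻ x, ∑' i, ‖F i x‖ₑ ∂μ :=
        lintegral_mono_ae (hf.mono fun x hx => hx.tsum_eq ▸ enorm_tsum_le_tsum_enorm)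
    _ = ENNReal.ofReal (∑' i, ∫ x, ‖F i x‖ ∂μ) := by
        rw [lintegral_tsum fun i => (hF i).1.enorm,
          ENNReal.ofReal_tsum_of_nonneg (fun i => integral_nonneg fun x => norm_nonneg _) hsum]
        simp only [ofReal_integral_norm_eq_lintegral_enorm (hF _)]
    _ < ⊤ := ENNReal.ofReal_lt_top

variable {α ζ C : ℝ} {c : ℕ → ℝ}

lemma laplace_kernelDensity (hα : 0 < α) (hc : ∀ k, |c k| ≤ C * 2 ^ k) (hs : 0 < s.re)
    (hsum : Summable fun k : ℕ => |c (k + 1)| * (|ζ| * s.re ^ (-α)) ^ (k + 1)) :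
    IntegrableOn (fun x : ℝ => Complex.exp (-s * x) * (kernelDensity α c ζ x : ℂ)) (Ioi 0) ∧
    HasSum (fun k : ℕ => (c (k + 1) : ℂ) * (ζ * s ^ (-α : ℂ)) ^ (k + 1))
      (∫ x in Ioi (0 : ℝ), Complex.exp (-s * x) * (kernelDensity α c ζ x : ℂ)) := by
  set F : ℕ → ℝ → ℂ := fun k x => ((c (k + 1) * ζ ^ (k + 1) : ℝ) : ℂ) *
    (Complex.exp (-s * x) * (powerKernel (α * (k + 1)) x : ℂ)) with hF
  have hpos (k : ℕ) : 0 < α * (k + 1) := by positivity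
  have hinteg (k : ℕ) : IntegrableOn (F k) (Ioi 0) :=
    (integrableOn_exp_mul_powerKernel (hpos k) hs).const_mul _
  have hnorm (k : ℕ) : ∫ x in Ioi (0 : ℝ), ‖F k x‖ =
      |c (k + 1)| * (|ζ| * s.re ^ (-α)) ^ (k + 1) := by
    simp only [hF, norm_mul ((_ : ℝ) : ℂ) (_ * _)]
    rw [integral_const_mul, integral_norm_exp_mul_powerKernel (hpos k) hs, Complex.norm_real,
      Real.norm_eq_abs, abs_mul, abs_pow, mul_pow, ← Real.rpow_mul_natCast hs.le, neg_mul,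
      mul_assoc]
    push_cast
    rfl
  have hlaplace (k : ℕ) : ∫ x in Ioi (0 : ℝ), F k x =
      (c (k + 1) : ℂ) * (ζ * s ^ (-α : ℂ)) ^ (k + 1) := by
    simp only [hF]
    rw [integral_const_mul, integral_exp_mul_powerKernel (hpos k) hs, mul_pow,
      ← Complex.cpow_mul_nat]
    push_cast
    ring_nf
  have hpoint : ∀ᵐ x ∂volume.restrict (Ioi (0 : ℝ)),
      HasSum (fun k => F k x) (Complex.exp (-s * x) * (kernelDensity α c ζ x : ℂ)) := by
    filter_upwards [ae_restrict_mem measurableSet_Ioi] with x hx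
    refine ((Complex.hasSum_ofReal.2 (hasSum_kernelDensity hα ζ hc hx)).mul_left
      (Complex.exp (-s * x))).congr_fun fun k => ?_
    simp only [hF]
    push_cast
    ring
  simp only [← hnorm] at hsum
  refine ⟨integrable_of_hasSum_of_summable_integral_norm hinteg hsum hpoint, ?_⟩
  have htotal := hasSum_integral_of_summable_integral_norm hinteg hsum
  rw [integral_congr_ae (hpoint.mono fun x hx => hx.tsum_eq)] at htotal
  simpa only [hlaplace] using htotal

lemma norm_mul_cpow_neg_lt_one (hα : 0 < α) (hs : 0 < s.re) (hζ : |ζ| < s.re ^ α) :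
    |ζ| * s.re ^ (-α) < 1 ∧ ‖(ζ : ℂ) * s ^ (-α : ℂ)‖ < 1 := by
  have hlt : |ζ| * s.re ^ (-α) < 1 := by
    rwa [Real.rpow_neg hs.le, ← div_eq_mul_inv, div_lt_one (Real.rpow_pos_of_pos hs _)]
  refine ⟨hlt, lt_of_le_of_lt ?_ hlt⟩
  rw [norm_mul, Complex.norm_real, Real.norm_eq_abs, ← Complex.ofReal_neg, Complex.norm_cpow_real]
  gcongr ?_ * ?_
  exact Real.rpow_le_rpow_of_nonpos hs (Complex.re_le_norm s) (neg_nonpos.2 hα.le)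

lemma laplace_prabhakarDensity (hα : 0 < α) (m : ℕ) (hs : 0 < s.re) (hζ : |ζ| < s.re ^ α) :
    IntegrableOn (fun x : ℝ => Complex.exp (-s * x) * (prabhakarDensity α m ζ x : ℂ)) (Ioi 0) ∧
    1 + ∫ x in Ioi (0 : ℝ), Complex.exp (-s * x) * (prabhakarDensity α m ζ x : ℂ) =
      ((1 - (ζ : ℂ) * s ^ (-α : ℂ)) ^ m)⁻¹ := by
  obtain ⟨hreal, hcomplex⟩ := norm_mul_cpow_neg_lt_one hα hs hζ
  have hsum : Summable fun k : ℕ =>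
      |risingCoeff m (k + 1)| * (|ζ| * s.re ^ (-α)) ^ (k + 1) := by
    simp only [abs_of_nonneg (risingCoeff_nonneg (Nat.cast_nonneg m) _)]
    refine (summable_nat_add_iff 1).2 (hasSum_risingCoeff m ?_).summable
    rwa [abs_of_nonneg (by positivity)]
  have hdensity : EqOn (fun x : ℝ => Complex.exp (-s * x) * (prabhakarDensity α m ζ x : ℂ))
      (fun x => Complex.exp (-s * x) * (kernelDensity α (risingCoeff m) ζ x : ℂ)) (Ioi 0) :=
    fun x hx => by simp only [prabhakarDensity_eq_kernelDensity α m ζ hx]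
  obtain ⟨hinteg, hlaplace⟩ := laplace_kernelDensity hα (abs_risingCoeff_natCast_le m) hs hsum
  refine ⟨(integrableOn_congr_fun hdensity measurableSet_Ioi).2 hinteg, ?_⟩
  have hbinomial := (hasSum_risingCoeff_natCast m hcomplex).tsum_eq
  rw [(hasSum_risingCoeff_natCast m hcomplex).summable.tsum_eq_zero_add, risingCoeff_zero_right,
    hlaplace.tsum_eq, Complex.ofReal_one, pow_zero, one_mul] at hbinomial
  rwa [setIntegral_congr_fun measurableSet_Ioi hdensity]

end Laplace

section FractionalIntegral

variable {E F : Type*} [NormedAddCommGroup E] [NormedSpace ℝ E]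
  [NormedAddCommGroup F] [NormedSpace ℝ F] {a b t B : ℝ} {f f₁ f₂ : ℝ → E}

lemma powerKernel_sub_mul_powerKernel_sub_eq_zero (a b : ℝ) {s τ : ℝ} (hs : s ∉ Icc τ t) :
    powerKernel a (t - s) * powerKernel b (s - τ) = 0 := by
  rcases lt_or_ge s τ with hsτ | hsτ
  · rw [powerKernel_of_neg b (sub_neg.2 hsτ), mul_zero]
  · rw [powerKernel_of_neg a (sub_neg.2 (not_le.1 fun h => hs ⟨hsτ, h⟩)), zero_mul]

lemma setIntegral_rpow_mul_sub_rpow (ha : 0 < a) (hb : 0 < b) (ht : 0 < t) :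
    ∫ s in Icc 0 t, s ^ (b - 1) * (t - s) ^ (a - 1) =
      t ^ (b + a - 1) * ProbabilityTheory.beta b a := by
  have hcast : ∫ s in Icc 0 t, (s : ℂ) ^ ((b : ℂ) - 1) * ((t : ℂ) - s) ^ ((a : ℂ) - 1) =
      ((∫ s in Icc 0 t, s ^ (b - 1) * (t - s) ^ (a - 1) : ℝ) : ℂ) := by
    rw [← integral_complex_ofReal]
    refine setIntegral_congr_fun measurableSet_Icc fun s hs => ?_
    push_cast [Complex.ofReal_cpow hs.1, Complex.ofReal_cpow (sub_nonneg.2 hs.2)]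
    rfl
  have hbeta := Complex.betaIntegral_scaled b a ht
  rw [intervalIntegral.integral_of_le ht.le, ← integral_Icc_eq_integral_Ioc, hcast] at hbeta
  rw [ProbabilityTheory.beta_eq_betaIntegralReal b a hb ha, ← Complex.re_ofReal_mul,
    ← Complex.ofReal_re (∫ s in Icc 0 t, _), hbeta, Complex.ofReal_cpow ht.le]
  push_cast
  rfl

lemma integral_powerKernel_sub_mul_powerKernel (ha : 0 < a) (hb : 0 < b) (ht : 0 < t) :
    ∫ s, powerKernel a (t - s) * powerKernel b s = powerKernel (a + b) t := by
  rw [← setIntegral_eq_integral_of_forall_compl_eq_zero (s := Icc 0 t) fun s hs => by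
      simpa using powerKernel_sub_mul_powerKernel_sub_eq_zero a b hs,
    setIntegral_congr_fun (g := fun s => s ^ (b - 1) * (t - s) ^ (a - 1) *
      (Real.Gamma b * Real.Gamma a)⁻¹) measurableSet_Icc fun s hs => ?_,
    integral_mul_const, setIntegral_rpow_mul_sub_rpow ha hb ht, ProbabilityTheory.beta,
    powerKernel_of_nonneg _ ht.le, add_comm b a]
  · have := (Real.Gamma_pos_of_pos ha).ne'
    have := (Real.Gamma_pos_of_pos hb).ne'
    field_simp
  · simp only [powerKernel_of_nonneg _ hs.1, powerKernel_of_nonneg _ (sub_nonneg.2 hs.2)]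
    ring

lemma integral_powerKernel_sub_mul_powerKernel_sub (ha : 0 < a) (hb : 0 < b) {τ : ℝ}
    (hτ : τ < t) :
    ∫ s, powerKernel a (t - s) * powerKernel b (s - τ) = powerKernel (a + b) (t - τ) := by
  have hshift := integral_sub_right_eq_self
    (fun s => powerKernel a (t - τ - s) * powerKernel b s) (μ := volume) τ
  simpa only [sub_sub_sub_cancel_right,
    integral_powerKernel_sub_mul_powerKernel ha hb (sub_pos.2 hτ)] using hshift

lemma integrable_powerKernel_sub_mul_powerKernel_sub (ha : 0 < a) (hb : 0 < b) {τ : ℝ}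
    (hτ : τ < t) : Integrable fun s => powerKernel a (t - s) * powerKernel b (s - τ) := by
  refine Integrable.of_integral_ne_zero ?_
  rw [integral_powerKernel_sub_mul_powerKernel_sub ha hb hτ,
    powerKernel_of_nonneg _ (sub_nonneg.2 hτ.le)]
  have := sub_pos.2 hτ
  have := Real.Gamma_pos_of_pos (add_pos ha hb)
  positivity

/-- The Riemann–Liouville fractional integral of order `a`, based at `0`, as the convolution with
`powerKernel a`. -/
noncomputable def fracIntegral (a : ℝ) (f : ℝ → E) (t : ℝ) : E :=
  ∫ s in Ioc 0 t, powerKernel a (t - s) • f s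

lemma fracIntegral_congr (h : ∀ s ∈ Ioc 0 t, f₁ s = f₂ s) :
    fracIntegral a f₁ t = fracIntegral a f₂ t :=
  setIntegral_congr_fun measurableSet_Ioc fun s hs => by simp only [h s hs]

lemma fracIntegral_one (f : ℝ → E) (t : ℝ) : fracIntegral 1 f t = ∫ s in Ioc 0 t, f s :=
  setIntegral_congr_fun measurableSet_Ioc fun s hs => by
    simp [powerKernel_one, heaviside, hs.2]

lemma setIntegral_powerKernel_sub (ha : 0 < a) (ht : 0 ≤ t) :
    ∫ s in Ioc 0 t, powerKernel a (t - s) = powerKernel (a + 1) t := by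
  rcases ht.eq_or_lt with rfl | ht
  · simp [powerKernel_of_nonneg, Real.zero_rpow ha.ne']
  · have hvanish : ∀ s ∉ Icc 0 t, powerKernel a (t - s) * powerKernel 1 s = 0 := fun s hs => by
      simpa only [sub_zero] using powerKernel_sub_mul_powerKernel_sub_eq_zero a 1 hs
    rw [← integral_powerKernel_sub_mul_powerKernel ha one_pos ht,
      ← setIntegral_eq_integral_of_forall_compl_eq_zero hvanish, integral_Icc_eq_integral_Ioc]
    refine setIntegral_congr_fun measurableSet_Ioc fun s hs => ?_
    simp [powerKernel_one, heaviside, hs.1.le]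

lemma integrableOn_powerKernel_sub (ha : 0 < a) (t : ℝ) :
    IntegrableOn (fun s => powerKernel a (t - s)) (Ioc 0 t) := by
  rcases le_or_gt t 0 with ht | ht
  · simp [Ioc_eq_empty_of_le ht]
  · refine Integrable.of_integral_ne_zero ?_
    rw [setIntegral_powerKernel_sub ha ht.le, powerKernel_of_nonneg _ ht.le]
    have := Real.Gamma_pos_of_pos (add_pos ha one_pos)
    positivity

lemma integrableOn_powerKernel_sub_smul (ha : 0 < a) (hf : ContinuousOn f (Icc 0 t)) :
    IntegrableOn (fun s => powerKernel a (t - s) • f s) (Ioc 0 t) := by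
  obtain ⟨B, hB⟩ := isCompact_Icc.exists_bound_of_continuousOn hf
  refine (integrableOn_powerKernel_sub ha t).smul_bdd B
    ((hf.mono Ioc_subset_Icc_self).aestronglyMeasurable measurableSet_Ioc) ?_
  filter_upwards [ae_restrict_mem measurableSet_Ioc] with s hs using hB s (Ioc_subset_Icc_self hs)

lemma fracIntegral_const [CompleteSpace E] (ha : 0 < a) (ht : 0 ≤ t) (v : E) :
    fracIntegral a (fun _ => v) t = powerKernel (a + 1) t • v := by
  rw [fracIntegral, integral_smul_const, setIntegral_powerKernel_sub ha ht]

lemma fracIntegral_sub (ha : 0 < a) (h₁ : ContinuousOn f₁ (Icc 0 t))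
    (h₂ : ContinuousOn f₂ (Icc 0 t)) :
    fracIntegral a (fun s => f₁ s - f₂ s) t = fracIntegral a f₁ t - fracIntegral a f₂ t := by
  simp only [fracIntegral, smul_sub]
  exact integral_sub (integrableOn_powerKernel_sub_smul ha h₁)
    (integrableOn_powerKernel_sub_smul ha h₂)

lemma fracIntegral_clm_comp [CompleteSpace E] [CompleteSpace F] (ha : 0 < a) (L : E →L[ℝ] F)
    (hf : ContinuousOn f (Icc 0 t)) :
    fracIntegral a (fun s => L (f s)) t = L (fracIntegral a f t) := by
  simp only [fracIntegral, ← map_smul]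
  exact L.integral_comp_comm (integrableOn_powerKernel_sub_smul ha hf)

lemma norm_fracIntegral_le (ha : 0 < a) (ht : 0 ≤ t) (hf : ∀ s ∈ Ioc 0 t, ‖f s‖ ≤ B) :
    ‖fracIntegral a f t‖ ≤ powerKernel (a + 1) t * B := by
  rw [← setIntegral_powerKernel_sub ha ht, ← integral_mul_const]
  refine norm_integral_le_of_norm_le ((integrableOn_powerKernel_sub ha t).mul_const B) ?_
  filter_upwards [ae_restrict_mem measurableSet_Ioc] with s hs
  have hk := powerKernel_nonneg ha (t - s)
  rw [norm_smul, Real.norm_of_nonneg hk]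
  exact mul_le_mul_of_nonneg_left (hf s hs) hk

lemma setIntegral_powerKernel_sub_mul_powerKernel_sub (ha : 0 < a) (hb : 0 < b) {τ : ℝ}
    (hτ : τ ∈ Ioo 0 t) :
    ∫ s in Ioc 0 t, powerKernel a (t - s) * powerKernel b (s - τ) =
      powerKernel (a + b) (t - τ) := by
  rw [← integral_powerKernel_sub_mul_powerKernel_sub ha hb hτ.2]
  exact setIntegral_eq_integral_of_forall_compl_eq_zero fun s hs =>
    powerKernel_sub_mul_powerKernel_sub_eq_zero a b fun h => hs ⟨hτ.1.trans_le h.1, h.2⟩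

lemma ae_restrict_Ioc_mem_Ioo (t : ℝ) : ∀ᵐ τ ∂volume.restrict (Ioc 0 t), τ ∈ Ioo 0 t := by
  rw [← restrict_Ioo_eq_restrict_Ioc]
  exact ae_restrict_mem measurableSet_Ioo

lemma integrable_prod_powerKernel_sub_mul_smul (ha : 0 < a) (hb : 0 < b)
    (hf : AEStronglyMeasurable f (volume.restrict (Ioc 0 t)))
    (hinteg : IntegrableOn (fun τ => powerKernel (a + b) (t - τ) • f τ) (Ioc 0 t)) :
    Integrable (fun z : ℝ × ℝ => (powerKernel a (t - z.1) * powerKernel b (z.1 - z.2)) • f z.2)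
      ((volume.restrict (Ioc 0 t)).prod (volume.restrict (Ioc 0 t))) := by
  have hk : Measurable fun z : ℝ × ℝ => powerKernel a (t - z.1) * powerKernel b (z.1 - z.2) :=
    ((measurable_powerKernel a).comp (by fun_prop)).mul
      ((measurable_powerKernel b).comp (by fun_prop))
  have hmeas : AEStronglyMeasurable (fun z : ℝ × ℝ =>
      (powerKernel a (t - z.1) * powerKernel b (z.1 - z.2)) • f z.2)
      ((volume.restrict (Ioc 0 t)).prod (volume.restrict (Ioc 0 t))) :=
    hk.aestronglyMeasurable.smul hf.comp_snd
  rw [integrable_prod_iff' hmeas]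
  constructor
  · filter_upwards [ae_restrict_Ioc_mem_Ioo t] with τ hτ
    exact (integrable_powerKernel_sub_mul_powerKernel_sub ha hb hτ.2).integrableOn.smul_const _
  · refine hinteg.norm.congr ?_
    filter_upwards [ae_restrict_Ioc_mem_Ioo t] with τ hτ
    simp only [norm_smul, Real.norm_of_nonneg (powerKernel_nonneg (add_pos ha hb) _),
      Real.norm_of_nonneg (mul_nonneg (powerKernel_nonneg ha _) (powerKernel_nonneg hb _))]
    rw [integral_mul_const, setIntegral_powerKernel_sub_mul_powerKernel_sub ha hb hτ]

lemma fracIntegral_fracIntegral [CompleteSpace E] (ha : 0 < a) (hb : 0 < b)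
    (hf : AEStronglyMeasurable f (volume.restrict (Ioc 0 t)))
    (hinteg : IntegrableOn (fun τ => powerKernel (a + b) (t - τ) • f τ) (Ioc 0 t)) :
    fracIntegral a (fracIntegral b f) t = fracIntegral (a + b) f t := by
  have hinner (s : ℝ) (hs : s ∈ Ioc 0 t) :
      fracIntegral b f s = ∫ τ in Ioc 0 t, powerKernel b (s - τ) • f τ := by
    refine (setIntegral_eq_of_subset_of_forall_sdiff_eq_zero measurableSet_Ioc
      (Ioc_subset_Ioc_right hs.2) fun τ hτ => ?_).symm
    rw [powerKernel_of_neg b (sub_neg.2 (not_le.1 fun h => hτ.2 ⟨hτ.1.1, h⟩)), zero_smul]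
  calc fracIntegral a (fracIntegral b f) t
      = ∫ s in Ioc 0 t, ∫ τ in Ioc 0 t,
          (powerKernel a (t - s) * powerKernel b (s - τ)) • f τ := by
        refine setIntegral_congr_fun measurableSet_Ioc fun s hs => ?_
        simp only [hinner s hs, mul_smul, integral_smul]
    _ = ∫ τ in Ioc 0 t, ∫ s in Ioc 0 t,
          (powerKernel a (t - s) * powerKernel b (s - τ)) • f τ :=
        integral_integral_swap (integrable_prod_powerKernel_sub_mul_smul ha hb hf hinteg)
    _ = fracIntegral (a + b) f t := by
        refine integral_congr_ae ?_
        filter_upwards [ae_restrict_Ioc_mem_Ioo t] with τ hτ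
        rw [integral_smul_const, setIntegral_powerKernel_sub_mul_powerKernel_sub ha hb hτ]

lemma caputoDeriv_eq_fracIntegral_deriv {β : ℝ} (hβ : β ≠ 1) (f : ℝ → ℝ) (ht : 0 ≤ t) :
    caputoDeriv β f t = fracIntegral (1 - β) (deriv f) t := by
  rw [caputoDeriv, if_neg hβ, intervalIntegral.integral_of_le ht, ← integral_const_mul]
  refine setIntegral_congr_fun measurableSet_Ioc fun s hs => ?_
  rw [powerKernel_of_nonneg _ (sub_nonneg.2 hs.2), sub_sub_cancel_left, smul_eq_mul]
  ring

lemma fracIntegral_caputoDeriv {β : ℝ} (hβ : β ∈ Ioc (0 : ℝ) 1) {f : ℝ → ℝ}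
    (hf : IntegrableOn (deriv f) (Ioc 0 t)) :
    fracIntegral β (caputoDeriv β f) t = ∫ τ in Ioc 0 t, deriv f τ := by
  rw [← fracIntegral_one]
  rcases eq_or_ne β 1 with rfl | hne
  · exact fracIntegral_congr fun s _ => if_pos rfl
  · have hlt : 0 < 1 - β := sub_pos.2 (hβ.2.lt_of_ne hne)
    rw [fracIntegral_congr fun s hs => caputoDeriv_eq_fracIntegral_deriv hne f hs.1.le,
      fracIntegral_fracIntegral hβ.1 hlt hf.aestronglyMeasurable, add_sub_cancel]
    refine hf.congr_fun (fun s hs => ?_) measurableSet_Ioc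
    simp [powerKernel_one, heaviside, hs.2]

lemma eq_add_fracIntegral_of_caputoDeriv_eq {β : ℝ} (hβ : β ∈ Ioc (0 : ℝ) 1) {f F : ℝ → ℝ}
    (hc : ContinuousOn f (Ici 0)) (hd : DifferentiableOn ℝ f (Ioi 0))
    (hi : IntegrableOn (deriv f) (Ioc 0 t)) (hF : ∀ s, 0 < s → caputoDeriv β f s = F s)
    (ht : 0 ≤ t) : f t = f 0 + fracIntegral β F t := by
  rw [← fracIntegral_congr fun s hs => hF s hs.1, fracIntegral_caputoDeriv hβ hi,
    ← intervalIntegral.integral_of_le ht,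
    intervalIntegral.integral_eq_sub_of_hasDerivAt_of_le ht (hc.mono Icc_subset_Ici_self)
      (fun x hx => (hd.differentiableAt (Ioi_mem_nhds hx.1)).hasDerivAt)
      ((intervalIntegrable_iff_integrableOn_Ioc_of_le ht).2 hi), add_sub_cancel]

end FractionalIntegral

section VolterraEquation

variable {E : Type*} [NormedAddCommGroup E] [NormedSpace ℝ E]
  {β t : ℝ} {A : E →L[ℝ] E} {u : ℝ → E} {u₀ : E}

lemma norm_pow_apply_le (A : E →L[ℝ] E) (m : ℕ) {v : E} {b : ℝ} (hv : ‖v‖ ≤ b) :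
    ‖(A ^ m) v‖ ≤ ‖A‖ ^ m * b := by
  induction m with
  | zero => simpa using hv
  | succ m ih =>
    rw [pow_succ', pow_succ', mul_assoc]
    exact A.le_of_opNorm_le_of_le le_rfl ih

lemma powerKernel_mul_natCast_add_one (β : ℝ) (ht : 0 ≤ t) (m : ℕ) :
    powerKernel (β * m + 1) t = (t ^ β) ^ m / Real.Gamma (β * m + 1) := by
  rw [powerKernel_add_one_of_nonneg _ ht, Real.rpow_mul_natCast ht]

lemma summable_powerKernel_mul_pow (hβ : 0 < β) (ht : 0 ≤ t) (z : ℝ) :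
    Summable fun m : ℕ => powerKernel (β * m + 1) t * z ^ m := by
  refine .of_norm_bounded (summable_abs_two_mul_pow_div_Gamma hβ (t ^ β * z)) fun m => ?_
  rw [powerKernel_mul_natCast_add_one β ht, div_mul_eq_mul_div, ← mul_pow, Real.norm_eq_abs]
  exact le_mul_of_one_le_left (abs_nonneg _) (one_le_pow₀ one_le_two)

lemma eq_sum_add_fracIntegral_of_volterra [CompleteSpace E] (hβ : 0 < β)
    (hu : ContinuousOn u (Ici 0))
    (hvolterra : ∀ s, 0 ≤ s → u s = u₀ + fracIntegral β (fun r => A (u r)) s) (ht : 0 ≤ t)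
    (M : ℕ) :
    u t = ∑ m ∈ Finset.range (M + 1), powerKernel (β * m + 1) t • (A ^ m) u₀ +
      fracIntegral (β * (M + 1)) (fun s => (A ^ (M + 1)) (u s)) t := by
  have hcont {s : ℝ} (L : E →L[ℝ] E) : ContinuousOn (fun r => L (u r)) (Icc 0 s) :=
    L.continuous.comp_continuousOn (hu.mono Icc_subset_Ici_self)
  induction M with
  | zero => simpa [powerKernel_one, heaviside, ht] using hvolterra t ht
  | succ M ih =>
    have hM : 0 < β * (M + 1) := by positivity
    have hadd : β * (M + 1) + β = β * ((M + 1 : ℕ) + 1) := by push_cast; ring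
    have hsemigroup : fracIntegral (β * ((M + 1 : ℕ) + 1)) (fun s => (A ^ (M + 1 + 1)) (u s)) t =
        fracIntegral (β * (M + 1)) (fracIntegral β fun s => (A ^ (M + 1 + 1)) (u s)) t := by
      rw [fracIntegral_fracIntegral hM hβ
        (((hcont _).mono Ioc_subset_Icc_self).aestronglyMeasurable measurableSet_Ioc)
        (integrableOn_powerKernel_sub_smul (by positivity) (hcont _)), hadd]
    have hinner (s : ℝ) (hs : s ∈ Ioc 0 t) : fracIntegral β (fun r => (A ^ (M + 1 + 1)) (u r)) s =
        (A ^ (M + 1)) (u s) - (A ^ (M + 1)) u₀ := by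
      rw [← map_sub, hvolterra s hs.1.le, add_sub_cancel_left,
        ← fracIntegral_clm_comp hβ _ (hcont A)]
      rfl
    rw [Finset.sum_range_succ, hsemigroup, fracIntegral_congr hinner,
      fracIntegral_sub hM (hcont _) continuousOn_const, fracIntegral_const hM ht, Nat.cast_succ,
      add_assoc, add_sub_cancel]
    exact ih

lemma hasSum_powerKernel_smul_of_volterra [CompleteSpace E] (hβ : 0 < β)
    (hu : ContinuousOn u (Ici 0))
    (hvolterra : ∀ s, 0 ≤ s → u s = u₀ + fracIntegral β (fun r => A (u r)) s) (ht : 0 ≤ t) :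
    HasSum (fun m : ℕ => powerKernel (β * m + 1) t • (A ^ m) u₀) (u t) := by
  obtain ⟨B, hB⟩ := isCompact_Icc.exists_bound_of_continuousOn
    (hu.mono (Icc_subset_Ici_self : Icc 0 t ⊆ Ici 0))
  have hsummable := summable_powerKernel_mul_pow hβ ht ‖A‖
  have hnorm : Summable fun m : ℕ => ‖powerKernel (β * m + 1) t • (A ^ m) u₀‖ := by
    refine .of_nonneg_of_le (fun _ => norm_nonneg _) (fun m => ?_) (hsummable.mul_right ‖u₀‖)
    have hk := powerKernel_nonneg (by positivity : 0 < β * m + 1) t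
    rw [norm_smul, Real.norm_of_nonneg hk, mul_assoc]
    exact mul_le_mul_of_nonneg_left (norm_pow_apply_le A m le_rfl) hk
  rw [hasSum_iff_tendsto_nat_of_summable_norm hnorm, ← tendsto_add_atTop_iff_nat 1,
    tendsto_iff_norm_sub_tendsto_zero]
  refine squeeze_zero (fun _ => norm_nonneg _) (fun M => ?_)
    (zero_mul B ▸ ((tendsto_add_atTop_iff_nat 1).2 hsummable.tendsto_atTop_zero).mul_const B)
  rw [norm_sub_rev, eq_sum_add_fracIntegral_of_volterra hβ hu hvolterra ht M, add_sub_cancel_left,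
    mul_assoc, Nat.cast_succ]
  exact norm_fracIntegral_le (by positivity) ht fun s hs =>
    norm_pow_apply_le A (M + 1) (hB s (Ioc_subset_Icc_self hs))

end VolterraEquation

section ConvolutionSystem

variable {β c t : ℝ} {g : ℕ → ℝ} {D : ℕ → ℕ → ℝ} {p : ℕ → ℝ → ℝ}

/-- `D m` is the `m`-th convolution power of the sequence `g`, that is, `D m n` is the coefficient
of `u ^ n` in the `m`-th power of the generating function of `g`. -/
structure IsConvPower (g : ℕ → ℝ) (D : ℕ → ℕ → ℝ) : Prop where
  zero : ∀ n, D 0 n = if n = 0 then 1 else 0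
  succ : ∀ m n, D (m + 1) n = ∑ k ∈ Finset.range (n + 1), D m k * g (n - k)

/-- The convolution with `g` on sequences truncated after the index `N`; it is well defined because
the convolution is lower triangular. -/
noncomputable def truncatedConvolution (g : ℕ → ℝ) (N : ℕ) :
    (Fin (N + 1) → ℝ) →L[ℝ] (Fin (N + 1) → ℝ) :=
  ContinuousLinearMap.pi fun n =>
    ∑ k : Fin (N + 1), (if k ≤ n then g (n - k) else 0) • ContinuousLinearMap.proj k

lemma truncatedConvolution_apply (g : ℕ → ℝ) (N : ℕ) (v : ℕ → ℝ) (n : Fin (N + 1)) :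
    truncatedConvolution g N (fun k => v k) n =
      ∑ k ∈ Finset.range (n + 1), v k * g (n - k) := by
  have hfilter : (Finset.range (N + 1)).filter (· ≤ (n : ℕ)) = Finset.range (n + 1) := by
    ext k; simp; omega
  rw [← hfilter, Finset.sum_filter, Finset.sum_range, truncatedConvolution,
    ContinuousLinearMap.pi_apply, sum_apply]
  refine Finset.sum_congr rfl fun k _ => ?_
  rw [smul_apply, ContinuousLinearMap.proj_apply, smul_eq_mul, ite_mul, zero_mul, mul_comm]
  exact if_congr Fin.le_def rfl rfl

lemma IsConvPower.smul_truncatedConvolution_pow (hD : IsConvPower g D) (c : ℝ) (N m : ℕ) :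
    ((c • truncatedConvolution g N) ^ m) (fun k : Fin (N + 1) => D 0 k) =
      fun k : Fin (N + 1) => c ^ m * D m k := by
  induction m with
  | zero => simp
  | succ m ih =>
    ext n
    rw [pow_succ', mul_apply_eq_comp, ih, smul_apply, Pi.smul_apply,
      truncatedConvolution_apply g N (fun k => c ^ m * D m k), hD.succ, smul_eq_mul, pow_succ',
      mul_assoc, Finset.mul_sum _ _ (c ^ m)]
    simp only [mul_assoc]

lemma IsConvPower.hasSum_of_caputoDeriv_eq (hD : IsConvPower g D) (hβ : β ∈ Ioc (0 : ℝ) 1)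
    (hc : ∀ n, ContinuousOn (p n) (Ici 0)) (hd : ∀ n, DifferentiableOn ℝ (p n) (Ioi 0))
    (hi : ∀ n, ∀ T : ℝ, IntegrableOn (deriv (p n)) (Ioc 0 T))
    (hinit : ∀ n, p n 0 = if n = 0 then 1 else 0)
    (hevol : ∀ n, ∀ s : ℝ, 0 < s →
      caputoDeriv β (p n) s = c * ∑ k ∈ Finset.range (n + 1), p k s * g (n - k))
    (ht : 0 ≤ t) (n : ℕ) :
    HasSum (fun m : ℕ => (c * t ^ β) ^ m / Real.Gamma (β * m + 1) * D m n) (p n t) := by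
  set A := c • truncatedConvolution g n
  have hcont : ContinuousOn (fun s (k : Fin (n + 1)) => p k s) (Ici 0) :=
    continuousOn_pi.2 fun k => hc k
  have hvolterra (s : ℝ) (hs : 0 ≤ s) : (fun k : Fin (n + 1) => p k s) =
      (fun k : Fin (n + 1) => D 0 k) + fracIntegral β (fun r => A fun k => p k r) s := by
    ext k
    have hproj := fracIntegral_clm_comp (t := s) hβ.1 (ContinuousLinearMap.proj (R := ℝ) k)
      (A.continuous.comp_continuousOn (hcont.mono Icc_subset_Ici_self))
    refine (eq_add_fracIntegral_of_caputoDeriv_eq hβ (hc k) (hd k) (hi k s) (hevol k) hs).trans ?_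
    rw [hinit, ← hD.zero]
    refine congrArg (D 0 k + ·) (Eq.trans (fracIntegral_congr fun r _ => ?_) hproj)
    exact congrArg (c * ·) (truncatedConvolution_apply g n (fun k => p k r) k).symm
  have hseries := hasSum_powerKernel_smul_of_volterra hβ.1 hcont hvolterra ht
  simp only [A, hD.smul_truncatedConvolution_pow c n] at hseries
  refine (Pi.hasSum.1 hseries (Fin.last n)).congr_fun fun m => ?_
  rw [Pi.smul_apply, powerKernel_mul_natCast_add_one β ht, mul_pow, smul_eq_mul, Fin.val_last]
  ring

end ConvolutionSystem

section StateProbabilities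

variable {α β lam lam₀ ξ t : ℝ}

lemma tendsto_mul_rpow_nhdsGT_zero (hα : 0 < α) (lam₀ : ℝ) :
    Tendsto (fun h : ℝ => lam₀ * h ^ α) (𝓝[>] 0) (𝓝 0) := by
  simpa only [mul_zero] using (tendsto_rpow_nhdsGT_zero hα).const_mul lam₀

lemma eventually_abs_mul_rpow_mul_le (hα : 0 < α) (lam₀ : ℝ) :
    ∀ᶠ h : ℝ in 𝓝[>] 0, |lam₀ * h ^ α| * 2 ^ α ≤ 1 / 4 := by
  have hlim := (tendsto_mul_rpow_nhdsGT_zero hα lam₀).abs.mul_const ((2 : ℝ) ^ α)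
  rw [abs_zero, zero_mul] at hlim
  exact hlim.eventually_le_const (by norm_num)

lemma isLatticeApprox_discretePrabhakar (hα : 0 < α) (lam₀ : ℝ) (m : ℕ) :
    IsLatticeApprox α (-lam₀) (2 ^ m) (risingCoeff m) (fun _ => risingCoeff m)
      fun h => discretePrabhakar α m (lam₀ * h ^ α) where
  tendsto _ := tendsto_const_nhds
  abs_le := Eventually.of_forall fun _ => abs_risingCoeff_natCast_le m
  hasSum := by
    filter_upwards [eventually_abs_mul_rpow_mul_le hα lam₀] with h hlam n
    rw [discretePrabhakar_eq_tsum hα.le hlam, ← neg_mul]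
    refine (summable_mul_pow_mul_risingCoeff hα.le ?_ (abs_risingCoeff_natCast_le m) n).hasSum
    rwa [neg_mul, abs_neg]

lemma summable_two_pow_mul_abs_mlCoeff (hβ : 0 < β) (ξ t : ℝ) :
    Summable fun m => 2 ^ m * |mlCoeff β ξ t m| :=
  summable_abs_two_mul_pow_div_Gamma hβ (-ξ * t ^ β)

lemma abs_mlCoeff_le_of_abs_le {ξ₁ ξ₂ : ℝ} (hξ : |ξ₁| ≤ |ξ₂|) (β t : ℝ) (m : ℕ) :
    |mlCoeff β ξ₁ t m| ≤ |mlCoeff β ξ₂ t m| := by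
  simp only [mlCoeff, abs_div, abs_pow, abs_mul, abs_neg]
  gcongr

lemma tendsto_mlCoeff {ι : Type*} {l : Filter ι} {η : ι → ℝ} (hη : Tendsto η l (𝓝 ξ))
    (β t : ℝ) (m : ℕ) : Tendsto (fun i => mlCoeff β (η i) t m) l (𝓝 (mlCoeff β ξ t m)) :=
  ((hη.neg.mul_const _).pow m).div_const _

theorem IsStateProb.hasSum_mlCoeff_mul_discretePrabhakar {p : ℕ → ℝ → ℝ}
    (hp : IsStateProb α β lam ξ p) (hα : 0 ≤ α) (hβ : β ∈ Ioc (0 : ℝ) 1)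
    (hlam : |lam| * 2 ^ α ≤ 1 / 4) (ht : 0 ≤ t) (n : ℕ) :
    HasSum (fun m => mlCoeff β (ξ * (lam + 1)) t m * discretePrabhakar α m lam n) (p n t) :=
  IsConvPower.hasSum_of_caputoDeriv_eq
    ⟨discretePrabhakar_zero α lam, discretePrabhakar_succ hα hlam⟩ hβ hp.continuousOn
    (fun n => (hp.contDiffOn n).differentiableOn one_ne_zero) hp.integrable_deriv hp.init
    (fun n s hs => neg_mul ξ (lam + 1) ▸ hp.evol n s hs) ht n

lemma IsStateProb.hasSum_superposedWeight {p : ℕ → ℝ → ℝ} (hp : IsStateProb α β lam ξ p)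
    (hα : 0 ≤ α) (hβ : β ∈ Ioc (0 : ℝ) 1) (hlam : |lam| * 2 ^ α ≤ 1 / 4) (ht : 0 ≤ t) (n : ℕ) :
    HasSum (fun s : ℕ => superposedWeight (mlCoeff β (ξ * (lam + 1)) t) s *
      ((-lam) ^ s * risingCoeff (α * s) n)) (p n t) := by
  have ha := summable_two_pow_mul_abs_mlCoeff hβ.1 (ξ * (lam + 1)) t
  have hseries := hp.hasSum_mlCoeff_mul_discretePrabhakar hα hβ hlam ht n
  simp only [discretePrabhakar_eq_tsum hα hlam] at hseries
  rw [← abs_neg] at hlam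
  rw [hseries.unique (hasSum_mul_tsum_risingCoeff ha
    (summable_two_pow_mul_abs_pow_mul_risingCoeff hα hlam n))]
  exact (summable_mul_pow_mul_risingCoeff hα hlam (abs_superposedWeight_le ha) n).hasSum

lemma isLatticeApprox_stateProb (hα : 0 < α) (hβ : β ∈ Ioc (0 : ℝ) 1) {p : ℝ → ℕ → ℝ → ℝ}
    (hp : ∀ᶠ h in 𝓝[>] 0, IsStateProb α β (lam₀ * h ^ α) ξ (p h)) (ht : 0 ≤ t) :
    IsLatticeApprox α (-lam₀) (∑' m, 2 ^ m * |mlCoeff β (ξ * 2) t m|)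
      (superposedWeight (mlCoeff β ξ t))
      (fun h => superposedWeight (mlCoeff β (ξ * (lam₀ * h ^ α + 1)) t)) fun h n => p h n t := by
  have hsummable (η : ℝ) := summable_two_pow_mul_abs_mlCoeff hβ.1 η t
  have hlim : Tendsto (fun h : ℝ => lam₀ * h ^ α + 1) (𝓝[>] 0) (𝓝 1) := by
    simpa only [zero_add] using (tendsto_mul_rpow_nhdsGT_zero hα lam₀).add_const 1
  have hrate : ∀ᶠ h : ℝ in 𝓝[>] 0, |ξ * (lam₀ * h ^ α + 1)| ≤ |ξ * 2| := by
    filter_upwards [hlim.abs.eventually_le_const (by norm_num : |(1 : ℝ)| < |2|)] with h hh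
    rw [abs_mul, abs_mul]
    gcongr
  refine ⟨fun s => ?_, ?_, ?_⟩
  · refine tendsto_tsum_of_dominated_convergence ((hsummable (ξ * 2)).mul_right (2 ^ s))
      (fun m => (tendsto_mlCoeff ?_ β t m).mul_const _) ?_
    · simpa only [mul_one] using hlim.const_mul ξ
    · filter_upwards [hrate] with h hh m
      refine (abs_mul_risingCoeff_natCast_le _ m s).trans ?_
      exact mul_le_mul_of_nonneg_right (mul_le_mul_of_nonneg_left
        (abs_mlCoeff_le_of_abs_le hh β t m) (by positivity)) (by positivity)
  · filter_upwards [hrate] with h hh s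
    refine (abs_superposedWeight_le (hsummable _) s).trans ?_
    gcongr ?_ * _
    exact (hsummable _).tsum_le_tsum
      (fun m => mul_le_mul_of_nonneg_left (abs_mlCoeff_le_of_abs_le hh β t m) (by positivity))
      (hsummable _)
  · filter_upwards [hp, eventually_abs_mul_rpow_mul_le hα lam₀] with h hph hlam n
    simpa only [neg_mul] using hph.hasSum_superposedWeight hα.le hβ hlam ht n

end StateProbabilities

section PrabhakarKernels

variable {α : ℝ}

lemma prabhakarKernel_natCast_eq_seriesKernel (hα : 0 < α) (ζ : ℝ) (m : ℕ) :
    prabhakarKernel α m ζ = seriesKernel α (risingCoeff m) ζ :=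
  prabhakarKernel_eq_seriesKernel hα ζ (abs_risingCoeff_natCast_le m)

lemma prabhakarKernel_natCast_eq_lineDeriv (hα : 0 < α) (ζ : ℝ) (m : ℕ) :
    prabhakarKernel α m ζ =
      ∂_{(1 : ℝ)} (regularDist fun x => heaviside x * prabhakar α 1 m (ζ * x ^ α)) := by
  simp only [heaviside_mul_prabhakar_eq_kernelPrimitive, prabhakarKernel_natCast_eq_seriesKernel hα,
    lineDeriv_regularDist_kernelPrimitive hα ζ (abs_risingCoeff_natCast_le m)]

variable {a : ℕ → ℝ} (ha : Summable fun m => 2 ^ m * |a m|)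
include ha

lemma hasSum_mul_prabhakarKernel (hα : 0 < α) (ζ : ℝ) (φ : 𝓓((⊤ : Opens ℝ), ℝ)) :
    HasSum (fun m : ℕ => a m * prabhakarKernel α m ζ φ)
      (seriesKernel α (superposedWeight a) ζ φ) := by
  simpa only [prabhakarKernel_natCast_eq_seriesKernel hα] using hasSum_mul_seriesKernel ha hα ζ φ

lemma hasSum_mul_prabhakarDensity (hα : 0 < α) (ζ : ℝ) {x : ℝ} (hx : 0 < x) :
    HasSum (fun m : ℕ => a m * prabhakarDensity α m ζ x)
      (kernelDensity α (superposedWeight a) ζ x) := by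
  simpa only [prabhakarDensity_eq_kernelDensity _ _ _ hx] using hasSum_mul_kernelDensity ha hα ζ hx

lemma hasSum_mul_prabhakar (hα : 0 < α) (ζ : ℝ) {x : ℝ} (hx : 0 ≤ x) :
    HasSum (fun m : ℕ => a m * prabhakar α 1 m (ζ * x ^ α))
      (kernelPrimitive α (superposedWeight a) ζ x) := by
  simpa only [← heaviside_mul_prabhakar_eq_kernelPrimitive, heaviside, if_pos hx, one_mul] using
    hasSum_mul_kernelPrimitive ha hα ζ hx

lemma seriesKernel_superposedWeight_eq_lineDeriv (hα : 0 < α) (ζ : ℝ) :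
    seriesKernel α (superposedWeight a) ζ = ∂_{(1 : ℝ)} (regularDist fun x =>
      heaviside x * ∑' m : ℕ, a m * prabhakar α 1 m (ζ * x ^ α)) := by
  rw [← lineDeriv_regularDist_kernelPrimitive hα ζ (abs_superposedWeight_le ha)]
  congr 2
  ext x
  rcases lt_or_ge x 0 with hx | hx
  · rw [kernelPrimitive_of_neg _ _ _ hx, heaviside, if_neg hx.not_ge, zero_mul]
  · rw [(hasSum_mul_prabhakar ha hα ζ hx).tsum_eq, heaviside, if_pos hx, one_mul]

end PrabhakarKernels

end SpaceTimeML

open SpaceTimeML in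
theorem mainTheorem2_general {α β : ℝ} (hα : 0 < α) (hβ : β ∈ Ioc (0 : ℝ) 1) (lam₀ ξ : ℝ) :
    (∀ m : ℕ,
      (∀ φ : 𝓓((⊤ : Opens ℝ), ℝ),
        Tendsto (fun h : ℝ =>
            regularDist (latticeDensity h
              (discretePrabhakar α m (lam₀ * h ^ α))) φ)
          (𝓝[>] 0) (𝓝 (prabhakarKernel α m (-lam₀) φ))) ∧
      (∀ x : ℝ, 0 < x →
        Tendsto (fun h : ℝ => (1 / h) *
            discretePrabhakar α m (lam₀ * h ^ α) ⌊x / h⌋₊)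
          (𝓝[>] 0) (𝓝 (prabhakarDensity α m (-lam₀) x))) ∧
      prabhakarKernel α m (-lam₀) =
        ∂_{(1 : ℝ)} (regularDist fun x =>
          heaviside x * prabhakar α 1 m (-lam₀ * x ^ α)) ∧
      (∀ s : ℂ, 0 < s.re → |lam₀| < s.re ^ α →
        IntegrableOn (fun x : ℝ => Complex.exp (-s * x) *
          (prabhakarDensity α m (-lam₀) x : ℂ)) (Ioi 0) ∧
        1 + ∫ x in Ioi (0 : ℝ), Complex.exp (-s * x) *
            (prabhakarDensity α m (-lam₀) x : ℂ) =
          ((1 + (lam₀ : ℂ) * s ^ (-(α : ℂ))) ^ m)⁻¹)) ∧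
    (∀ p : ℝ → ℕ → ℝ → ℝ,
      (∀ᶠ h in 𝓝[>] (0 : ℝ), IsStateProb α β (lam₀ * h ^ α) ξ (p h)) →
      ∀ t : ℝ, 0 ≤ t →
        ∃ P : 𝓓'((⊤ : Opens ℝ), ℝ),
          (∀ φ : 𝓓((⊤ : Opens ℝ), ℝ),
            Tendsto (fun h : ℝ =>
                regularDist (latticeDensity h fun n => p h n t) φ)
              (𝓝[>] 0) (𝓝 (P φ))) ∧
          (∀ φ : 𝓓((⊤ : Opens ℝ), ℝ),
            HasSum (fun m : ℕ => mlCoeff β ξ t m *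
              prabhakarKernel α m (-lam₀) φ) (P φ)) ∧
          (∀ x : ℝ, 0 < x →
            Summable (fun m : ℕ => mlCoeff β ξ t m *
              prabhakarDensity α m (-lam₀) x) ∧
            Tendsto (fun h : ℝ => (1 / h) * p h ⌊x / h⌋₊ t) (𝓝[>] 0)
              (𝓝 (∑' m : ℕ, mlCoeff β ξ t m *
                prabhakarDensity α m (-lam₀) x))) ∧
          (∀ x : ℝ, 0 ≤ x →
            Summable (fun m : ℕ => mlCoeff β ξ t m *
              prabhakar α 1 m (-lam₀ * x ^ α))) ∧
          P = ∂_{(1 : ℝ)} (regularDist fun x =>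
            heaviside x * ∑' m : ℕ, mlCoeff β ξ t m *
              prabhakar α 1 m (-lam₀ * x ^ α))) := by
  refine ⟨fun m => ?_, fun p hp t ht => ?_⟩
  · have happrox := isLatticeApprox_discretePrabhakar hα lam₀ m
    refine ⟨fun φ => ?_, fun x hx => ?_, prabhakarKernel_natCast_eq_lineDeriv hα _ m,
      fun s hs hlam => ?_⟩
    · rw [prabhakarKernel_natCast_eq_seriesKernel hα]
      exact happrox.tendsto_regularDist hα φ
    · rw [prabhakarDensity_eq_kernelDensity _ _ _ hx]
      simpa only [latticeDensity, if_pos hx.le] using happrox.tendsto_latticeDensity hα hx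
    · simpa only [Complex.ofReal_neg, neg_mul, sub_neg_eq_add] using
        laplace_prabhakarDensity hα m hs ((abs_neg lam₀).trans_lt hlam)
  · have ha := summable_two_pow_mul_abs_mlCoeff hβ.1 ξ t
    have happrox := isLatticeApprox_stateProb hα hβ hp ht
    refine ⟨seriesKernel α (superposedWeight (mlCoeff β ξ t)) (-lam₀),
      happrox.tendsto_regularDist hα, hasSum_mul_prabhakarKernel ha hα _, fun x hx => ?_,
      fun x hx => (hasSum_mul_prabhakar ha hα _ hx).summable,
      seriesKernel_superposedWeight_eq_lineDeriv ha hα _⟩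
    have hdensity := hasSum_mul_prabhakarDensity ha hα (-lam₀) hx
    refine ⟨hdensity.summable, ?_⟩
    rw [hdensity.tsum_eq]
    simpa only [latticeDensity, if_pos hx.le] using happrox.tendsto_latticeDensity hα hx

theorem mainTheorem2 (α β lam₀ ξ : ℝ) (hα : α ∈ Ioc (0 : ℝ) 1) (hβ : β ∈ Ioc (0 : ℝ) 1)
    (hlam₀ : 0 < lam₀) (hξ : 0 < ξ) :
    -- the Prabhakar kernels `e^m_{α,0}(-lam₀, ·)`
    (∀ m : ℕ,
      -- limits of the discrete coefficients, as distributions on `ℝ` and at each point `x > 0`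
      (∀ φ : 𝓓((⊤ : Opens ℝ), ℝ),
        Tendsto (fun h : ℝ =>
            SpaceTimeML.regularDist (SpaceTimeML.latticeDensity h
              (SpaceTimeML.discretePrabhakar α m (lam₀ * h ^ α))) φ)
          (𝓝[>] 0) (𝓝 (SpaceTimeML.prabhakarKernel α m (-lam₀) φ))) ∧
      (∀ x : ℝ, 0 < x →
        Tendsto (fun h : ℝ => (1 / h) *
            SpaceTimeML.discretePrabhakar α m (lam₀ * h ^ α) ⌊x / h⌋₊)
          (𝓝[>] 0) (𝓝 (SpaceTimeML.prabhakarDensity α m (-lam₀) x))) ∧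
      -- `e^m_{α,0}(-lam₀, x) = D_x [Θ(x) E^m_{α,1}(-lam₀ x ^ α)]`
      SpaceTimeML.prabhakarKernel α m (-lam₀) =
        ∂_{(1 : ℝ)} (SpaceTimeML.regularDist fun x =>
          SpaceTimeML.heaviside x * SpaceTimeML.prabhakar α 1 m (-lam₀ * x ^ α)) ∧
      -- the Laplace transform is `(1 + lam₀ s ^ (-α)) ^ (-m)`
      (∀ s : ℂ, 0 < s.re → lam₀ < s.re ^ α →
        IntegrableOn (fun x : ℝ => Complex.exp (-s * x) *
          (SpaceTimeML.prabhakarDensity α m (-lam₀) x : ℂ)) (Ioi 0) ∧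
        1 + ∫ x in Ioi (0 : ℝ), Complex.exp (-s * x) *
            (SpaceTimeML.prabhakarDensity α m (-lam₀) x : ℂ) =
          ((1 + (lam₀ : ℂ) * s ^ (-(α : ℂ))) ^ m)⁻¹)) ∧
    -- the state density
    (∀ p : ℝ → ℕ → ℝ → ℝ,
      (∀ h : ℝ, 0 < h → SpaceTimeML.IsStateProb α β (lam₀ * h ^ α) ξ (p h)) →
      ∀ t : ℝ, 0 ≤ t →
        ∃ P : 𝓓'((⊤ : Opens ℝ), ℝ),
          -- `P` is the limit of the rescaled state probabilities
          (∀ φ : 𝓓((⊤ : Opens ℝ), ℝ),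
            Tendsto (fun h : ℝ =>
                SpaceTimeML.regularDist (SpaceTimeML.latticeDensity h fun n => p h n t) φ)
              (𝓝[>] 0) (𝓝 (P φ))) ∧
          -- `P = ∑ₘ (-ξ t ^ β) ^ m / Γ(β m + 1) e^m_{α,0}(-lam₀, ·)`
          (∀ φ : 𝓓((⊤ : Opens ℝ), ℝ),
            HasSum (fun m : ℕ => SpaceTimeML.mlCoeff β ξ t m *
              SpaceTimeML.prabhakarKernel α m (-lam₀) φ) (P φ)) ∧
          -- the same at each point `x > 0`
          (∀ x : ℝ, 0 < x →
            Summable (fun m : ℕ => SpaceTimeML.mlCoeff β ξ t m *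
              SpaceTimeML.prabhakarDensity α m (-lam₀) x) ∧
            Tendsto (fun h : ℝ => (1 / h) * p h ⌊x / h⌋₊ t) (𝓝[>] 0)
              (𝓝 (∑' m : ℕ, SpaceTimeML.mlCoeff β ξ t m *
                SpaceTimeML.prabhakarDensity α m (-lam₀) x))) ∧
          -- `P = D_x [Θ(x) ∑ₘ (-ξ t ^ β) ^ m / Γ(β m + 1) E^m_{α,1}(-lam₀ x ^ α)]`
          (∀ x : ℝ, 0 ≤ x →
            Summable (fun m : ℕ => SpaceTimeML.mlCoeff β ξ t m *
              SpaceTimeML.prabhakar α 1 m (-lam₀ * x ^ α))) ∧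
          P = ∂_{(1 : ℝ)} (SpaceTimeML.regularDist fun x =>
            SpaceTimeML.heaviside x * ∑' m : ℕ, SpaceTimeML.mlCoeff β ξ t m *
              SpaceTimeML.prabhakar α 1 m (-lam₀ * x ^ α))) := by
  obtain ⟨hkernel, hstate⟩ := abs_of_pos hlam₀ ▸ mainTheorem2_general hα.1 hβ lam₀ ξ
  exact ⟨hkernel, fun p hp => hstate p (eventually_mem_nhdsWithin.mono hp)⟩
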